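/- **Setting.** Let $(M,d)$ be a metric space of diameter $D$, normalized so that $1\le D<\infty$. An input consists of an initial state $s_0\in M$, cost functions $c_1,\dots,c_T:M\to[0,\infty]$, and the states $s_t^i$ ($1\le i\le \ell$, $0\le t\le T$, $s_0^i=s_0$) of $\ell\ge1$ heuristics, all fixed in advance. The heuristics' costs $f_t(i)=c_t(s_t^i)+d(s_{t-1}^i,s_t^i)$ are assumed to lie in $[0,2D]$. Let $$\mathrm{OPT}_{\le k}=\min_{i_1,\dots,i_T}\sum_{t=1}^T\big(c_t(s_t^{i_t})+d(s_{t-1}^{i_{t-1}},s_t^{i_t})\big),$$ the minimum being over sequences with at most $k$ indices $t\ge 2$ such that $i_{t-1}\ne i_t$. With $m$-delayed bandit access ($m\ge2$), the algorithm queries one heuristic per step $t=1,\dots,T$, and the query of $H_i$ at time $t$ reveals $s_t^i$ if and only if $H_i$ was queried in all of the steps $t-m+2,\dots,t$. **Learning dynamics** (exploration rate $\rho$, learning rate $\eta$, sharing parameter $\alpha$). Let $\beta_0=0$; let $\beta_t\sim\mathrm{Bernoulli}(\rho)$ and $e_t$ uniform on $\{1,\dots,\ell\}$ for $t\ge1$,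 all independent. Step $0$ is an exploitation step. If $t$ is an exploitation step and $\beta_t=0$, then $t+1$ is an exploitation step; if $\beta_t=1$, then $H_{e_{t+m}}$ is queried in steps $t+1,\dots,t+m$, step $t+m$ is an exploration step, and $t+m+1$ is an exploitation step. SHARE starts with weights $w(i)=1$. After an exploration step $t$ it receives the loss vector $g$ with $g(e_t)=f_t(e_t)/(2D)$ and $g(i)=0$ for $i\ne e_t$, and replaces $w(i)$ by $w(i)e^{-\eta g(i)}+\frac{\alpha}{\ell}\sum_j w(j)(1-e^{-\eta g(j)})$; no other step changes the weights. The vector $x_t$ is the normalized weight vector before step $t$. **Algorithm 2.** Choose $i_0$ uniformly at random. At time $t\ge 1$, if $x_t=x_{t-1}$, let $i_t=i_{t-1}$; otherwise let $i_t=j$ with probability $\tau_{i_{t-1},j}/x_{t-1}(i_{t-1})$, where $\tau$ is a transport plan from $x_{t-1}$ to $x_t$ that moves the least possible mass. In exploitation steps query $H_{i_t}$. If $s_t^{i_t}$ is known, go to $s_t=s_t^{i_t}$ and set $b_t=s_t$; otherwise set $b_t=b_{t-1}$ (with $b_0=s_0$) and go to some $s_t\in\arg\min_{s\in M}(d(b_t,s)+c_t(s))$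 (assumed to exist). The cost is $\mathrm{ALG}=\sum_{t=1}^T(c_t(s_t)+d(s_{t-1},s_t))$. For a given $k\ge1$ the parameters are tuned as $$\rho=\frac{(D\ell k)^{1/3}}{m^{4/3}\,\mathrm{OPT}_{\le k}^{1/3}},\qquad \alpha=\frac{D\ell k}{\rho\,\mathrm{OPT}_{\le k}},\qquad \gamma=\sqrt{\alpha},\qquad \eta=\ln\frac1{1-\gamma}.$$ **Claim.** In the regime $D\ell m\le o(\mathrm{OPT}_{\le k}^{1/3})$, Algorithm 2 with SHARE is $(1+\varepsilon)$-competitive against $\mathrm{OPT}_{\le k}$ for $k$ as large as $\Omega\big(\varepsilon^3\mathrm{OPT}_{\le k}/(D\ell m^2(\ln Z)^3)\big)$. Precisely, there are absolute constants $c_0,c>0$ such that for all such inputs, all integers $\ell\ge 1$, $m\ge2$, $k\ge1$, every $\varepsilon\in(0,1]$, and every choice of minimizers and optimal transport plans in the algorithm: if $$D\ell m\le c_0\,\mathrm{OPT}_{\le k}^{1/3}\qquad\text{and}\qquad k\le c\,\frac{\varepsilon^3\,\mathrm{OPT}_{\le k}}{D\ell m^2(\ln Z)^3},\qquad Z=\frac{\ell^{1/3}\,\mathrm{OPT}_{\le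 k}^{2/3}}{D^{2/3}m^{4/3}},$$ then the parameters are admissible ($0<\rho\le1$, $0<\alpha\le\frac12$, $\eta>0$) and $$\mathbb E[\mathrm{ALG}]\le(1+\varepsilon)\,\mathrm{OPT}_{\le k}.$$ -/

import Mathlib

open scoped ENNReal

noncomputable section

namespace MTS

/-! ### Metrical task systems with heuristics and the benchmark -/

/-- An input of a metrical task system on the metric space `M` together with the solutions of
`ℓ` heuristics (all fixed in advance, the adversary being oblivious). Only the values
`cost t`, `1 ≤ t ≤ T`, and `state t`, `0 ≤ t ≤ T`, matter. Costs may be infinite at some states;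
each heuristic pays at most twice the diameter in every step. -/
structure Input (M : Type*) [MetricSpace M] (ℓ : ℕ) where
  /-- number of time steps -/
  T : ℕ
  /-- the cost function `c_t` -/
  cost : ℕ → M → ℝ≥0∞
  /-- the common initial state -/
  start : M
  /-- the state of heuristic `i` at time `t` -/
  state : ℕ → Fin ℓ → M
  state_zero : ∀ i, state 0 i = start
  step_le : ∀ t < T, ∀ i,
    cost (t + 1) (state (t + 1) i) + edist (state t i) (state (t + 1) i)
      ≤ ENNReal.ofReal (2 * Metric.diam (Set.univ : Set M))

/-- The diameter `D` of the metric space. -/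
def diameter (M : Type*) [MetricSpace M] : ℝ := Metric.diam (Set.univ : Set M)

variable {M : Type*} [MetricSpace M] {ℓ : ℕ}

/-- `f_t(i)`: the cost incurred by heuristic `i` at time `t ≥ 1`. -/
def Input.heuristicCost (I : Input M ℓ) (t : ℕ) (i : Fin ℓ) : ℝ≥0∞ :=
  I.cost t (I.state t i) + edist (I.state (t - 1) i) (I.state t i)

/-- The cost of being, at each time `t = 1, …, T`, in the state of heuristic `a t`
(at time `0` all heuristics are in the same state). -/
def Input.combinationCost (I : Input M ℓ) (a : ℕ → Fin ℓ) : ℝ≥0∞ :=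
  ∑ t ∈ Finset.Icc 1 I.T,
    (I.cost t (I.state t (a t)) + edist (I.state (t - 1) (a (t - 1))) (I.state t (a t)))

/-- The number of switches of `a 1, …, a T`. -/
def switches (T : ℕ) (a : ℕ → Fin ℓ) : ℕ :=
  ((Finset.Icc 2 T).filter fun t => a (t - 1) ≠ a t).card

/-- `OPT_{≤ k}`: the cost of the best combination of the heuristics with at most `k` switches. -/
def Input.opt (I : Input M ℓ) (k : ℕ) : ℝ :=
  (⨅ (a : ℕ → Fin ℓ) (_ : switches I.T a ≤ k), I.combinationCost a).toReal

/-! ### SHARE -/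

/-- One update of the weights of SHARE with learning rate `η` and sharing parameter `α`
after the loss vector `g`. -/
def shareUpdate (η α : ℝ) (g w : Fin ℓ → ℝ) : Fin ℓ → ℝ := fun i =>
  w i * Real.exp (-η * g i) + α * (∑ j, (w j - w j * Real.exp (-η * g j))) / ℓ

/-! ### Learning dynamics: exploration, exploitation and the fractional solution -/

/-- The schedule determined by the coins `β` (with `β 0 = false`). The value is `0` if `t` is an
exploitation step. If `t` is an exploitation step with `β t = true`, then the values at
`t + 1, …, t + m` are `m, …, 1`; the step `t + m`, with value `1`, is the exploration step, and
`t + m + 1` is again an exploitation step. -/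
def countdown (m : ℕ) (β : ℕ → Bool) : ℕ → ℕ
  | 0 => 0
  | t + 1 => if countdown m β t = 0 then (if β t then m else 0) else countdown m β t - 1

/-- The loss vector fed to the learning algorithm in the exploration step `t`: the cost of the
explored heuristic `e t`, scaled by `1 / (2D)`, and `0` for the other heuristics. -/
def Input.feedback (I : Input M ℓ) (e : ℕ → Fin ℓ) (t : ℕ) : Fin ℓ → ℝ := fun i =>
  if i = e t then (I.heuristicCost t (e t)).toReal / (2 * diameter M) else 0

/-- The weights of SHARE before time `t`; they are updated after exploration steps only. -/
def Input.weights (I : Input M ℓ) (m : ℕ) (η α : ℝ) (β : ℕ → Bool) (e : ℕ → Fin ℓ) :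
    ℕ → Fin ℓ → ℝ
  | 0 => fun _ => 1
  | t + 1 =>
    if countdown m β t = 1 then shareUpdate η α (I.feedback e t) (I.weights m η α β e t)
    else I.weights m η α β e t

/-- The fractional solution `x_t`, a distribution over the heuristics. -/
def Input.fractional (I : Input M ℓ) (m : ℕ) (η α : ℝ) (β : ℕ → Bool) (e : ℕ → Fin ℓ)
    (t : ℕ) : Fin ℓ → ℝ := fun i =>
  I.weights m η α β e t i / ∑ j, I.weights m η α β e t j

/-! ### Rounding -/

/-- `τ i j` is the mass moved from `p i` to `p' j` by an optimal transport of `p` to `p'`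
(for the discrete metric). -/
structure IsTransport (p p' : Fin ℓ → ℝ) (τ : Fin ℓ → Fin ℓ → ℝ) : Prop where
  nonneg : ∀ i j, 0 ≤ τ i j
  row : ∀ i, ∑ j, τ i j = p i
  col : ∀ j, ∑ i, τ i j = p' j
  moved : ∑ i, ∑ j ∈ Finset.univ.erase i, τ i j = ∑ i, max 0 (p i - p' i)

/-- A choice of an optimal transport for every pair of distributions. -/
def IsRounding (τ : (Fin ℓ → ℝ) → (Fin ℓ → ℝ) → Fin ℓ → Fin ℓ → ℝ) : Prop :=
  ∀ p ∈ stdSimplex ℝ (Fin ℓ), ∀ p' ∈ stdSimplex ℝ (Fin ℓ), IsTransport p p' (τ p p')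

/-- The probability that the exploited heuristic changes from `i` to `j` when the fractional
solution changes from `p` to `p'`. -/
def transition (τ : (Fin ℓ → ℝ) → (Fin ℓ → ℝ) → Fin ℓ → Fin ℓ → ℝ) (p p' : Fin ℓ → ℝ)
    (i j : Fin ℓ) : ℝ :=
  if p' ≠ p then τ p p' i j / p i else if j = i then 1 else 0

/-! ### Producing the solution of the metrical task system -/

/-- The heuristic queried at time `t`: the exploited heuristic `a t` in an exploitation step;
otherwise, the heuristic to be explored at the end of the current block of `m` steps. -/
def query (m : ℕ) (β : ℕ → Bool) (e a : ℕ → Fin ℓ) (t : ℕ) : Fin ℓ :=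
  if countdown m β t = 0 then a t else e (t + countdown m β t - 1)

/-- `m`-delayed bandit access: the state of heuristic `i` at time `t` is known if and only if `i`
was queried in all the steps `t - m + 2, …, t` (queries start at time `1`). -/
def Known (m : ℕ) (q : ℕ → Fin ℓ) (i : Fin ℓ) (t : ℕ) : Prop :=
  m ≤ t + 1 ∧ ∀ u ∈ Finset.Icc (t + 2 - m) t, q u = i

instance (m : ℕ) (q : ℕ → Fin ℓ) (i : Fin ℓ) (t : ℕ) : Decidable (Known m q i t) :=
  inferInstanceAs (Decidable (_ ∧ _))

/-- `greedy t b` minimizes `d(b, s) + c_t(s)` over the states `s`; ties are broken arbitrarily. -/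
def Input.IsGreedy (I : Input M ℓ) (greedy : ℕ → M → M) : Prop :=
  ∀ t ∈ Finset.Icc 1 I.T, ∀ b s,
    edist b (greedy t b) + I.cost t (greedy t b) ≤ edist b s + I.cost t s

/-- The last known state `b_t` of an exploited heuristic, for the query sequence `q` and the
sequence `a` of exploited heuristics. -/
def Input.lastKnown (I : Input M ℓ) (m : ℕ) (q a : ℕ → Fin ℓ) : ℕ → M
  | 0 => I.start
  | t + 1 => if Known m q (a (t + 1)) (t + 1) then I.state (t + 1) (a (t + 1))
      else I.lastKnown m q a t

/-- The state `s_t` of the algorithm: the state of the exploited heuristic if it is known, and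
otherwise the result of a greedy step from the last known state. -/
def Input.position (I : Input M ℓ) (m : ℕ) (greedy : ℕ → M → M) (q a : ℕ → Fin ℓ) : ℕ → M
  | 0 => I.start
  | t + 1 => if Known m q (a (t + 1)) (t + 1) then I.state (t + 1) (a (t + 1))
      else greedy (t + 1) (I.lastKnown m q a (t + 1))

/-- The cost of the algorithm for given outcomes of all random choices. -/
def Input.algCost (I : Input M ℓ) (m : ℕ) (greedy : ℕ → M → M) (β : ℕ → Bool)
    (e a : ℕ → Fin ℓ) : ℝ≥0∞ :=
  ∑ t ∈ Finset.Icc 1 I.T,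
    (I.cost t (I.position m greedy (query m β e a) a t) +
      edist (I.position m greedy (query m β e a) a (t - 1))
        (I.position m greedy (query m β e a) a t))

/-! ### The expected cost -/

/-- The sequence with the terms `v 0, …, v (n - 1)` at the times `0, …, n - 1`. -/
def fromZero {A : Type*} [Inhabited A] {n : ℕ} (v : Fin n → A) (t : ℕ) : A :=
  if h : t < n then v ⟨t, h⟩ else default

/-- The sequence with the terms `v 0, …, v (n - 1)` at the times `1, …, n`. For `A = Bool`, the
term at time `0` is `false`. -/
def fromOne {A : Type*} [Inhabited A] {n : ℕ} (v : Fin n → A) : ℕ → A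
  | 0 => default
  | t + 1 => fromZero v t

/-- The probability of the outcome `(β, e, a)`: the coins `β_1, …, β_T` are independent
Bernoulli variables with parameter `ρ`, the heuristics to be explored are independent and uniform,
the first exploited heuristic `a_0` is uniform, and `a_t` is obtained from `a_{t-1}` by rounding.
(A block that starts before time `T` may end after it, by less than `m + 1` steps.) -/
def Input.prob [NeZero ℓ] (I : Input M ℓ) (m : ℕ) (ρ η α : ℝ)
    (τ : (Fin ℓ → ℝ) → (Fin ℓ → ℝ) → Fin ℓ → Fin ℓ → ℝ)
    (β : Fin I.T → Bool) (e : Fin (I.T + m) → Fin ℓ) (a : Fin (I.T + 1) → Fin ℓ) : ℝ :=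
  (∏ t, if β t then ρ else 1 - ρ) * (∏ _t : Fin (I.T + m), (1 / ℓ : ℝ)) * (1 / ℓ : ℝ) *
    ∏ t ∈ Finset.Icc 1 I.T,
      transition τ (I.fractional m η α (fromOne β) (fromOne e) (t - 1))
        (I.fractional m η α (fromOne β) (fromOne e) t) (fromZero a (t - 1)) (fromZero a t)

/-- The expected cost of the algorithm with exploration rate `ρ`, which uses SHARE with learning
rate `η` and sharing parameter `α`, with `m`-delayed bandit access to the heuristics. -/
def Input.expectedCost [NeZero ℓ] (I : Input M ℓ) (m : ℕ) (ρ η α : ℝ)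
    (τ : (Fin ℓ → ℝ) → (Fin ℓ → ℝ) → Fin ℓ → Fin ℓ → ℝ) (greedy : ℕ → M → M) : ℝ≥0∞ :=
  ∑ β : Fin I.T → Bool, ∑ e : Fin (I.T + m) → Fin ℓ, ∑ a : Fin (I.T + 1) → Fin ℓ,
    ENNReal.ofReal (I.prob m ρ η α τ β e a) *
      I.algCost m greedy (fromOne β) (fromOne e) (fromZero a)

/-! ### The choice of the parameters -/

/-- The exploration rate `OPT^{-1/3} (D ℓ k)^{1/3} m^{-4/3}`. -/
def exploreRate (D : ℝ) (ℓ m k : ℕ) (OPT : ℝ) : ℝ :=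
  OPT ^ (-(1 / 3) : ℝ) * (D * ℓ * k) ^ (1 / 3 : ℝ) * (m : ℝ) ^ (-(4 / 3) : ℝ)

/-- The sharing parameter `α = D ℓ k / (ρ OPT)`, where `ρ` is the exploration rate. -/
def shareParam (D : ℝ) (ℓ m k : ℕ) (OPT : ℝ) : ℝ :=
  D * ℓ * k / (exploreRate D ℓ m k OPT * OPT)

/-- The parameter `γ = √(D ℓ k / (ρ OPT))`. -/
def gammaParam (D : ℝ) (ℓ m k : ℕ) (OPT : ℝ) : ℝ :=
  √(D * ℓ * k / (exploreRate D ℓ m k OPT * OPT))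

/-- The learning rate `η = ln (1 / (1 - γ))`. -/
def learningRate (D : ℝ) (ℓ m k : ℕ) (OPT : ℝ) : ℝ :=
  Real.log (1 / (1 - gammaParam D ℓ m k OPT))

/-- `Z = ℓ^{1/3} OPT^{2/3} / (D^{2/3} m^{4/3})`. -/
def logArg (D : ℝ) (ℓ m : ℕ) (OPT : ℝ) : ℝ :=
  (ℓ : ℝ) ^ (1 / 3 : ℝ) * OPT ^ (2 / 3 : ℝ) / (D ^ (2 / 3 : ℝ) * (m : ℝ) ^ (4 / 3 : ℝ))

end MTS

end

/-! Exploration samples a uniform heuristic at a rate of about `ρ`, so up to the factor `ρ / ℓ` the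
losses fed to SHARE are unbiased samples of the costs. Comparing the total weight with the weight
that sharing guarantees along an offline solution with `k` switches bounds the explored cost of the
fractional solutions `x`, and the mass moved by `x` is at most `η` times the explored cost. An idle
step starts a new block with probability `ρ`, and `x` stands still during a block, so the cost of
following `x` is the explored cost divided by the rate, up to a multiple of the movement. Rounding
is a Markov chain with marginals `x t` which switches as often as `x` moves. Finally, the distance
of the last known state from the exploited heuristic grows only while a coin was tossed recently or
the heuristic was switched recently; such periods are rare and short, so this distance adds up to a
small multiple of the cost and of the movement. With `γ = ρ * m ^ 2`, every error term is of order
`γ * ln Z * OPT`. -/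

noncomputable section

namespace MTS

open Finset

/-! ### Product distributions -/

section ProductMean

variable {ι A : Type*} [Fintype ι] [DecidableEq ι] [Fintype A]

/-- The expectation of `G` under the product of the distributions `p i`. -/
def productMean (p : ι → A → ℝ) (G : (ι → A) → ℝ) : ℝ := ∑ v, (∏ i, p i (v i)) * G v

variable {p : ι → A → ℝ} {G H : (ι → A) → ℝ}

lemma productMean_mono (hp : ∀ i a, 0 ≤ p i a) (h : ∀ v, G v ≤ H v) :
    productMean p G ≤ productMean p H :=
  sum_le_sum fun v _ => mul_le_mul_of_nonneg_left (h v) (prod_nonneg fun i _ => hp i (v i))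

lemma productMean_add :
    productMean p (fun v => G v + H v) = productMean p G + productMean p H := by
  simp only [productMean, mul_add, sum_add_distrib]

lemma productMean_mul (c : ℝ) : productMean p (fun v => c * G v) = c * productMean p G := by
  simp only [productMean, mul_sum, mul_left_comm]

lemma productMean_sum {κ : Type*} (s : Finset κ) (K : κ → (ι → A) → ℝ) :
    productMean p (fun v => ∑ k ∈ s, K k v) = ∑ k ∈ s, productMean p (K k) := by
  simp only [productMean, mul_sum]
  exact sum_comm

lemma productMean_const (hp : ∀ i, ∑ a, p i a = 1) (c : ℝ) : productMean p (fun _ => c) = c := by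
  simp [productMean, ← sum_mul, ← Fintype.prod_sum, hp]

/-- Exchanging the coordinate `v i` with an independent sample `a` of it is measure preserving. -/
lemma productMean_resample (i : ι) (hp : ∑ a, p i a = 1) :
    productMean p G = productMean p fun v => ∑ a, p i a * G (Function.update v i a) := by
  let exchange : (ι → A) × A ≃ (ι → A) × A :=
    { toFun := fun q => (Function.update q.1 i q.2, q.1 i)
      invFun := fun q => (Function.update q.1 i q.2, q.1 i)
      left_inv := fun q => by simp
      right_inv := fun q => by simp }
  have weight_exchange (v : ι → A) (a : A) :
      (∏ j, p j (v j)) * p i a = (∏ j, p j (Function.update v i a j)) * p i (v i) := by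
    rw [← mul_prod_erase _ _ (mem_univ i), ← mul_prod_erase _ (fun j => p j _) (mem_univ i),
      Function.update_self, prod_congr rfl fun j hj => by
        rw [← Function.update_of_ne (ne_of_mem_erase hj) a v]]
    ring
  calc productMean p G
      = ∑ q : (ι → A) × A, (∏ j, p j (q.1 j)) * p i q.2 * G q.1 := by
        simp only [productMean, Fintype.sum_prod_type, ← sum_mul, ← mul_sum, hp, mul_one]
    _ = ∑ q : (ι → A) × A, (∏ j, p j (q.1 j)) * p i q.2 * G (Function.update q.1 i q.2) := by
        refine (Fintype.sum_equiv exchange _ _ fun q => ?_).symm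
        rw [weight_exchange]
        rfl
    _ = productMean p fun v => ∑ a, p i a * G (Function.update v i a) := by
        simp only [productMean, Fintype.sum_prod_type, mul_sum, mul_assoc]

end ProductMean

/-! ### Finite Markov chains -/

section MarkovChain

variable {A : Type*}

/-- The transition matrices `P 1, P 2, …` turn the distributions `x 0, x 1, …` into each other. -/
structure IsMarkovFlow [Fintype A] (x : ℕ → A → ℝ) (P : ℕ → A → A → ℝ) : Prop where
  flow : ∀ t j, ∑ i, x t i * P (t + 1) i j = x (t + 1) j
  row : ∀ t i, ∑ j, P (t + 1) i j = 1

/-- The probability that a Markov chain with initial distribution `μ` and transition matrices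
`P 1, P 2, …` starts with `a 0, …, a n`. -/
def pathWeight (μ : A → ℝ) (P : ℕ → A → A → ℝ) (n : ℕ) (a : ℕ → A) : ℝ :=
  μ (a 0) * ∏ t ∈ Icc 1 n, P t (a (t - 1)) (a t)

variable [Inhabited A]

lemma fromZero_snoc_of_lt {n t : ℕ} (a : Fin n → A) (b : A) (h : t < n) :
    fromZero (Fin.snoc a b : Fin (n + 1) → A) t = fromZero a t := by
  simp [fromZero, Fin.snoc, h, h.trans n.lt_succ_self]

lemma fromZero_snoc_self {n : ℕ} (a : Fin n → A) (b : A) :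
    fromZero (Fin.snoc a b : Fin (n + 1) → A) n = b := by
  simp [fromZero, Fin.snoc]

lemma pathWeight_snoc (μ : A → ℝ) (P : ℕ → A → A → ℝ) (n : ℕ) (a : Fin (n + 1) → A) (b : A) :
    pathWeight μ P (n + 1) (fromZero (Fin.snoc a b : Fin (n + 2) → A))
      = pathWeight μ P n (fromZero a) * P (n + 1) (fromZero a n) b := by
  have factor_eq : ∀ t ∈ Icc 1 n, P t (fromZero (Fin.snoc a b : Fin (n + 2) → A) (t - 1))
      (fromZero (Fin.snoc a b : Fin (n + 2) → A) t) = P t (fromZero a (t - 1)) (fromZero a t) := by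
    intro t ht
    rw [mem_Icc] at ht
    rw [fromZero_snoc_of_lt _ _ (by omega), fromZero_snoc_of_lt _ _ (by omega)]
  rw [pathWeight, pathWeight, prod_Icc_succ_top (by omega), prod_congr rfl factor_eq,
    fromZero_snoc_self, Nat.add_sub_cancel, fromZero_snoc_of_lt _ _ n.lt_succ_self,
    fromZero_snoc_of_lt _ _ n.succ_pos, mul_assoc]

variable [Fintype A]

/-- The expectation of a function of the first `n + 1` states of a Markov chain (the argument
of `F` is continued with default values). -/
def pathMean (μ : A → ℝ) (P : ℕ → A → A → ℝ) (n : ℕ) (F : (ℕ → A) → ℝ) : ℝ :=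
  ∑ a : Fin (n + 1) → A, pathWeight μ P n (fromZero a) * F (fromZero a)

lemma pathMean_succ (μ : A → ℝ) (P : ℕ → A → A → ℝ) (n : ℕ) (F : (ℕ → A) → ℝ) :
    pathMean μ P (n + 1) F = ∑ a : Fin (n + 1) → A, pathWeight μ P n (fromZero a) *
      ∑ b, P (n + 1) (fromZero a n) b * F (fromZero (Fin.snoc a b : Fin (n + 2) → A)) := by
  simp only [pathMean, mul_sum, ← mul_assoc, ← pathWeight_snoc]
  rw [sum_comm, ← Fintype.sum_prod_type']
  exact (Fintype.sum_equiv (Fin.snocEquiv fun _ => A) _ _ fun q => rfl).symm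

variable {μ : A → ℝ} {P : ℕ → A → A → ℝ} {x : ℕ → A → ℝ} {n s : ℕ} {F G : (ℕ → A) → ℝ}

lemma pathMean_add : pathMean μ P n (fun a => F a + G a) = pathMean μ P n F + pathMean μ P n G := by
  simp only [pathMean, mul_add, sum_add_distrib]

lemma pathMean_mul (c : ℝ) : pathMean μ P n (fun a => c * F a) = c * pathMean μ P n F := by
  simp only [pathMean, mul_sum, mul_left_comm]

lemma pathMean_sum {κ : Type*} (S : Finset κ) (K : κ → (ℕ → A) → ℝ) :
    pathMean μ P n (fun a => ∑ k ∈ S, K k a) = ∑ k ∈ S, pathMean μ P n (K k) := by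
  simp only [pathMean, mul_sum]
  exact sum_comm

namespace IsMarkovFlow

variable (h : IsMarkovFlow x P)
include h

lemma pathMean_last (g : A → ℝ) :
    pathMean (x 0) P n (fun a => g (a n)) = ∑ i, x n i * g i := by
  induction n generalizing g with
  | zero =>
    refine Fintype.sum_equiv (Equiv.funUnique (Fin 1) A) _ _ fun a => ?_
    simp [pathWeight, fromZero]
  | succ n ih =>
    rw [pathMean_succ]
    simp only [fromZero_snoc_self]
    refine (ih fun i => ∑ b, P (n + 1) i b * g b).trans ?_
    simp only [mul_sum, ← h.flow n, sum_mul, mul_assoc]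
    exact sum_comm

lemma pathMean_step (hs : s < n) (g : A → A → ℝ) :
    pathMean (x 0) P n (fun a => g (a s) (a (s + 1)))
      = ∑ i, ∑ j, x s i * P (s + 1) i j * g i j := by
  induction n with
  | zero => omega
  | succ n ih =>
    rw [pathMean_succ]
    rcases Nat.lt_succ_iff_lt_or_eq.1 hs with hlt | rfl
    · simp only [fromZero_snoc_of_lt _ _ (show s < n + 1 by omega),
        fromZero_snoc_of_lt _ _ (show s + 1 < n + 1 by omega), ← sum_mul, h.row, one_mul]
      exact ih hlt
    · simp only [fromZero_snoc_self, fromZero_snoc_of_lt _ _ s.lt_succ_self]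
      refine (h.pathMean_last fun i => ∑ b, P (s + 1) i b * g i b).trans ?_
      simp only [mul_sum, mul_assoc]

lemma pathMean_eval (hs : s < n) (g : A → ℝ) :
    pathMean (x 0) P n (fun a => g (a (s + 1))) = ∑ i, x (s + 1) i * g i := by
  rw [h.pathMean_step hs fun _ j => g j, sum_comm]
  simp only [← h.flow s, sum_mul]

lemma pathMean_const (hx : ∑ i, x n i = 1) (c : ℝ) : pathMean (x 0) P n (fun _ => c) = c := by
  rw [h.pathMean_last fun _ => c, ← sum_mul, hx, one_mul]

end IsMarkovFlow

end MarkovChain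

/-! ### Moved mass -/

section Moved

variable {ι : Type*} [Fintype ι]

/-- The mass moved from `p` to `p'` by an optimal transport for the discrete metric. -/
def moved (p p' : ι → ℝ) : ℝ := ∑ i, max 0 (p i - p' i)

lemma moved_nonneg (p p' : ι → ℝ) : 0 ≤ moved p p' := sum_nonneg fun _ _ => le_max_left _ _

lemma moved_self (p : ι → ℝ) : moved p p = 0 := by simp [moved]

lemma moved_comm {p p' : ι → ℝ} (h : ∑ i, p i = ∑ i, p' i) : moved p p' = moved p' p := by
  have max_swap (i : ι) : max 0 (p i - p' i) = max 0 (p' i - p i) + (p i - p' i) := by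
    rcases le_total (p i) (p' i) with h | h
    · rw [max_eq_left (by linarith), max_eq_right (by linarith)]; ring
    · rw [max_eq_right (by linarith), max_eq_left (by linarith)]; ring
  simp only [moved, max_swap, sum_add_distrib, sum_sub_distrib, h, sub_self, add_zero]

lemma moved_triangle (p q r : ι → ℝ) : moved p r ≤ moved p q + moved q r := by
  rw [moved, moved, moved, ← sum_add_distrib]
  refine sum_le_sum fun i _ => max_le (by positivity) ?_
  linarith [le_max_right 0 (p i - q i), le_max_right 0 (q i - r i)]

lemma moved_le_sum_moved (x : ℕ → ι → ℝ) {s t : ℕ} (h : s ≤ t) :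
    moved (x s) (x t) ≤ ∑ u ∈ Ioc s t, moved (x (u - 1)) (x u) := by
  induction t, h using Nat.le_induction with
  | base => simp [moved_self]
  | succ t h ih =>
    rw [sum_Ioc_succ_top h]
    exact (moved_triangle _ (x t) _).trans (by simpa using ih)

lemma sum_mul_le_add_moved {p p' F : ι → ℝ} {B : ℝ} (hF : ∀ i, 0 ≤ F i) (hFB : ∀ i, F i ≤ B) :
    ∑ i, p i * F i ≤ ∑ i, p' i * F i + B * moved p p' := by
  rw [moved, mul_sum, ← sum_add_distrib]
  refine sum_le_sum fun i _ => ?_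
  nlinarith [hF i, hFB i, le_max_right 0 (p i - p' i), le_max_left 0 (p i - p' i)]

end Moved

/-! ### The regret of SHARE -/

section Switches

variable {ℓ : ℕ} (T : ℕ) (a : ℕ → Fin ℓ)

lemma switches_add_two :
    switches (T + 2) a = switches (T + 1) a + if a (T + 1) = a (T + 2) then 0 else 1 := by
  have interval_eq : Icc 2 (T + 2) = insert (T + 2) (Icc 2 (T + 1)) := by
    ext; simp only [mem_Icc, mem_insert]; omega
  rw [switches, switches, interval_eq, filter_insert]
  by_cases h : a (T + 1) = a (T + 2)
  · simp [h]
  · rw [if_pos (by simpa using h), card_insert_of_notMem (by simp), if_neg h]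

lemma switches_succ_le : switches (T + 1) a ≤ switches T a + 1 := by
  rcases T with _ | T
  · simp [switches]
  · rw [switches_add_two]
    split_ifs <;> omega

end Switches

section Share

variable {ℓ : ℕ} {η α : ℝ} {g w : Fin ℓ → ℝ}

/-- The total weight removed by the losses `g` in an update of SHARE, before it is shared. -/
def removed (η : ℝ) (g w : Fin ℓ → ℝ) : ℝ := ∑ j, (w j - w j * Real.exp (-η * g j))

lemma removed_nonneg (hη : 0 ≤ η) (hg : ∀ i, 0 ≤ g i) (hw : ∀ i, 0 ≤ w i) :
    0 ≤ removed η g w := by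
  refine sum_nonneg fun i _ => sub_nonneg.2 (mul_le_of_le_one_right (hw i) ?_)
  exact Real.exp_le_one_iff.2 (by nlinarith [hg i])

lemma one_sub_exp_mul_le {s : ℝ} (hs : 0 ≤ s) (hs1 : s ≤ 1) :
    (1 - Real.exp (-η)) * s ≤ 1 - Real.exp (-η * s) := by
  have h := convexOn_exp.2 (Set.mem_univ (-η)) (Set.mem_univ 0) hs (sub_nonneg.2 hs1) (by ring)
  simp only [smul_eq_mul, mul_zero, add_zero, Real.exp_zero, mul_one, mul_comm s (-η)] at h
  linarith

lemma one_sub_exp_mul_sum_le_removed (hg : ∀ i, 0 ≤ g i) (hg1 : ∀ i, g i ≤ 1)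
    (hw : ∀ i, 0 ≤ w i) : (1 - Real.exp (-η)) * ∑ i, w i * g i ≤ removed η g w := by
  rw [removed, mul_sum]
  refine sum_le_sum fun i _ => ?_
  nlinarith [hw i, one_sub_exp_mul_le (η := η) (hg i) (hg1 i)]

lemma shareUpdate_apply (i : Fin ℓ) : shareUpdate η α g w i
    = w i * Real.exp (-η * g i) + 2 * (α / (2 * ℓ)) * removed η g w := by
  rw [shareUpdate, ← removed, mul_div_right_comm, ← mul_div_assoc, mul_div_mul_left _ _ two_ne_zero]

lemma shareUpdate_zero : shareUpdate η α (fun _ => 0) w = w := by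
  funext i; simp [shareUpdate]

lemma mul_exp_le_shareUpdate (hη : 0 ≤ η) (hα : 0 ≤ α) (hg : ∀ i, 0 ≤ g i) (hw : ∀ i, 0 ≤ w i)
    (i : Fin ℓ) : w i * Real.exp (-η * g i) ≤ shareUpdate η α g w i := by
  rw [shareUpdate_apply]
  have := removed_nonneg hη hg hw
  exact le_add_of_nonneg_right (by positivity)

lemma shareUpdate_pos (hη : 0 ≤ η) (hα : 0 ≤ α) (hg : ∀ i, 0 ≤ g i) (hw : ∀ i, 0 < w i)
    (i : Fin ℓ) : 0 < shareUpdate η α g w i :=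
  (mul_pos (hw i) (Real.exp_pos _)).trans_le
    (mul_exp_le_shareUpdate hη hα hg (fun i => (hw i).le) i)

lemma mul_le_sum_of_mul_sub_sum_le {ι : Type*} [Fintype ι] {w : ι → ℝ} (hw : ∀ i, 0 ≤ w i)
    {c B : ℝ} (hc : 2 * c ≤ 1) (j : ι) (hB : 2 * c * (B - ∑ i, w i) ≤ w j) : c * B ≤ ∑ i, w i := by
  nlinarith [single_le_sum (fun i _ => hw i) (mem_univ j), sum_nonneg fun i (_ : i ∈ univ) => hw i]

variable [NeZero ℓ]

lemma two_mul_shareRatio_le_one (hα1 : α ≤ 1) : 2 * (α / (2 * ℓ)) ≤ 1 := by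
  have hℓ : (1 : ℝ) ≤ ℓ := Nat.one_le_cast.2 (NeZero.pos ℓ)
  rw [mul_div_assoc', div_le_one (by positivity)]
  linarith

lemma sum_shareUpdate : ∑ i, shareUpdate η α g w i = ∑ i, w i - (1 - α) * removed η g w := by
  have hℓ : (ℓ : ℝ) ≠ 0 := Nat.cast_ne_zero.2 (NeZero.ne ℓ)
  have kept_eq : ∑ i, w i * Real.exp (-η * g i) = ∑ i, w i - removed η g w := by
    simp [removed, sum_sub_distrib]
  simp only [shareUpdate_apply, sum_add_distrib, kept_eq, sum_const, card_univ, Fintype.card_fin,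
    nsmul_eq_mul]
  field_simp
  ring

lemma moved_shareUpdate_le (hη : 0 ≤ η) (hα : 0 ≤ α) (hα1 : α ≤ 1) (hg : ∀ i, 0 ≤ g i)
    (hw : ∀ i, 0 < w i) :
    moved (fun i => w i / ∑ j, w j)
        (fun i => shareUpdate η α g w i / ∑ j, shareUpdate η α g w j)
      ≤ η * ∑ i, w i / (∑ j, w j) * g i := by
  have hw0 (i : Fin ℓ) : 0 ≤ w i := (hw i).le
  have total_pos : 0 < ∑ j, w j := sum_pos (fun i _ => hw i) univ_nonempty
  have updated_total_pos : 0 < ∑ j, shareUpdate η α g w j :=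
    sum_pos (fun i _ => shareUpdate_pos hη hα hg hw i) univ_nonempty
  have total_le : ∑ j, shareUpdate η α g w j ≤ ∑ j, w j := by
    rw [sum_shareUpdate]
    nlinarith [removed_nonneg hη hg hw0]
  rw [moved, mul_sum]
  refine sum_le_sum fun i _ => max_le (by have := hw0 i; have := hg i; positivity) ?_
  calc w i / ∑ j, w j - shareUpdate η α g w i / ∑ j, shareUpdate η α g w j
      ≤ w i / ∑ j, w j - w i * Real.exp (-η * g i) / ∑ j, w j :=
        sub_le_sub_left (div_le_div₀ (shareUpdate_pos hη hα hg hw i).le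
          (mul_exp_le_shareUpdate hη hα hg hw0 i) updated_total_pos total_le) _
    _ = w i / (∑ j, w j) * (1 - Real.exp (-η * g i)) := by ring
    _ ≤ w i / (∑ j, w j) * (η * g i) := by
        refine mul_le_mul_of_nonneg_left ?_ (div_nonneg (hw0 i) total_pos.le)
        linarith [Real.add_one_le_exp (-η * g i)]
    _ = η * (w i / (∑ j, w j) * g i) := by ring

lemma log_sum_shareUpdate_le (hη : 0 ≤ η) (hα : 0 ≤ α) (hα1 : α ≤ 1) (hg : ∀ i, 0 ≤ g i)
    (hg1 : ∀ i, g i ≤ 1) (hw : ∀ i, 0 < w i) :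
    Real.log (∑ i, shareUpdate η α g w i) ≤ Real.log (∑ i, w i) -
      (1 - α) * (1 - Real.exp (-η)) * ∑ i, w i / (∑ j, w j) * g i := by
  have total_pos : 0 < ∑ j, w j := sum_pos (fun i _ => hw i) univ_nonempty
  have updated_total_pos : 0 < ∑ j, shareUpdate η α g w j :=
    sum_pos (fun i _ => shareUpdate_pos hη hα hg hw i) univ_nonempty
  have ratio_le : (∑ j, shareUpdate η α g w j) / ∑ j, w j - 1
      ≤ -((1 - α) * (1 - Real.exp (-η)) * ∑ i, w i / (∑ j, w j) * g i) := by
    have mean_eq : ∑ i, w i / (∑ j, w j) * g i = (∑ i, w i * g i) / ∑ j, w j := by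
      simp only [sum_div, div_mul_eq_mul_div]
    rw [mean_eq, div_sub_one total_pos.ne', ← mul_div_assoc, ← neg_div, sum_shareUpdate]
    refine div_le_div_of_nonneg_right ?_ total_pos.le
    nlinarith [sub_nonneg.2 hα1,
      one_sub_exp_mul_sum_le_removed (η := η) hg hg1 fun i => (hw i).le]
  have h := Real.log_le_sub_one_of_pos (div_pos updated_total_pos total_pos)
  rw [Real.log_div updated_total_pos.ne' total_pos.ne'] at h
  linarith

end Share

/-- The weights `u` are produced by SHARE from the losses `G`. -/
structure IsShareRun {ℓ : ℕ} (η α : ℝ) (G u : ℕ → Fin ℓ → ℝ) : Prop where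
  loss_nonneg : ∀ t i, 0 ≤ G t i
  start_pos : ∀ i, 0 < u 0 i
  succ : ∀ t, u (t + 1) = shareUpdate η α (G t) (u t)

/-- The lower bound on the total weight guaranteed by the comparator `a`: each switch costs a
factor `α / (2ℓ)`, and each unit of loss of the comparator a factor `exp (-η)`. -/
def guaranteedWeight (η α : ℝ) (G u : ℕ → Fin ℓ → ℝ) (a : ℕ → Fin ℓ) (T : ℕ) : ℝ :=
  (α / (2 * ℓ)) ^ switches (T + 1) a * Real.exp (-η * ∑ t ∈ Icc 1 T, G t (a t)) * ∑ i, u 1 i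

namespace IsShareRun

variable {ℓ : ℕ} {η α : ℝ} {G u : ℕ → Fin ℓ → ℝ}

lemma weight_pos (h : IsShareRun η α G u) (hη : 0 ≤ η) (hα : 0 ≤ α) (t : ℕ) :
    ∀ i, 0 < u t i := by
  induction t with
  | zero => exact h.start_pos
  | succ t ih => rw [h.succ]; exact shareUpdate_pos hη hα (h.loss_nonneg t) ih

variable [NeZero ℓ]

lemma log_total_le (h : IsShareRun η α G u) (hη : 0 ≤ η) (hα : 0 ≤ α) (hα1 : α ≤ 1) {T : ℕ}
    (hG1 : ∀ t ≤ T, ∀ i, G t i ≤ 1) :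
    Real.log (∑ i, u (T + 1) i) ≤ Real.log (∑ i, u 1 i) -
      (1 - α) * (1 - Real.exp (-η)) * ∑ t ∈ Icc 1 T, ∑ i, u t i / (∑ j, u t j) * G t i := by
  induction T with
  | zero => simp
  | succ T ih =>
    rw [sum_Icc_succ_top (by omega), h.succ (T + 1), mul_add]
    linarith [ih fun t ht => hG1 t (ht.trans T.le_succ), log_sum_shareUpdate_le hη hα hα1
      (h.loss_nonneg (T + 1)) (hG1 (T + 1) le_rfl) (h.weight_pos hη hα (T + 1))]

/-- Of whatever the total weight falls short of the guaranteed weight, the share `α / ℓ` has gone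
to the comparator's current heuristic; hence the total cannot fall short by much. -/
lemma shareRatio_mul_guaranteedWeight_sub_le (h : IsShareRun η α G u) (hη : 0 ≤ η) (hα : 0 ≤ α)
    (hα1 : α ≤ 1) (a : ℕ → Fin ℓ) (T : ℕ) :
    2 * (α / (2 * ℓ)) * (guaranteedWeight η α G u a T - ∑ i, u (T + 1) i)
      ≤ u (T + 1) (a (T + 1)) := by
  have hpos := h.weight_pos hη hα
  induction T with
  | zero => simpa [guaranteedWeight, switches] using (hpos 1 (a 1)).le
  | succ T ih =>
    set t := T + 1
    set c : ℝ := α / (2 * ℓ)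
    set B := guaranteedWeight η α G u a T
    set E := Real.exp (-η * G t (a t))
    have hc0 : 0 ≤ c := by positivity
    have hE1 : E ≤ 1 := Real.exp_le_one_iff.2 (by nlinarith [h.loss_nonneg t (a t)])
    have guaranteed_eq : guaranteedWeight η α G u a t
        = (if a t = a (t + 1) then 1 else c) * (B * E) := by
      simp only [guaranteedWeight, B, E, c, t, switches_add_two,
        sum_Icc_succ_top (Nat.le_add_left 1 T), mul_add, Real.exp_add]
      split_ifs <;> ring
    have without_switch : 2 * c * (B * E - ∑ i, u (t + 1) i) ≤ u (t + 1) (a t) := by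
      rw [h.succ t, sum_shareUpdate, shareUpdate_apply]
      have hR := removed_nonneg hη (h.loss_nonneg t) fun i => (hpos t i).le
      have lost_le : (1 - α) * removed η (G t) (u t) ≤ removed η (G t) (u t) := by nlinarith
      have total_le : (∑ i, u t i) * E ≤ ∑ i, u t i :=
        mul_le_of_le_one_right (sum_nonneg fun i _ => (hpos t i).le) hE1
      calc 2 * c * (B * E - (∑ i, u t i - (1 - α) * removed η (G t) (u t)))
          ≤ 2 * c * ((B - ∑ i, u t i) * E + removed η (G t) (u t)) := by gcongr; linarith
        _ = 2 * c * (B - ∑ i, u t i) * E + 2 * c * removed η (G t) (u t) := by ring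
        _ ≤ u t (a t) * E + 2 * c * removed η (G t) (u t) := by gcongr
    by_cases hsw : a t = a (t + 1)
    · rwa [guaranteed_eq, if_pos hsw, one_mul, ← hsw]
    · rw [guaranteed_eq, if_neg hsw]
      have := mul_le_sum_of_mul_sub_sum_le (fun i => (hpos (t + 1) i).le)
        (two_mul_shareRatio_le_one hα1) _ without_switch
      nlinarith [hpos (t + 1) (a (t + 1))]

lemma shareRatio_mul_guaranteedWeight_le (h : IsShareRun η α G u) (hη : 0 ≤ η) (hα : 0 ≤ α)
    (hα1 : α ≤ 1) (a : ℕ → Fin ℓ) (T : ℕ) :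
    α / (2 * ℓ) * guaranteedWeight η α G u a T ≤ ∑ i, u (T + 1) i :=
  mul_le_sum_of_mul_sub_sum_le (fun i => (h.weight_pos hη hα (T + 1) i).le)
    (two_mul_shareRatio_le_one hα1) _ (h.shareRatio_mul_guaranteedWeight_sub_le hη hα hα1 a T)

lemma log_total_ge (h : IsShareRun η α G u) (hη : 0 ≤ η) (hα : 0 < α) (hα1 : α ≤ 1)
    (a : ℕ → Fin ℓ) (T : ℕ) :
    Real.log (∑ i, u 1 i) - η * ∑ t ∈ Icc 1 T, G t (a t)
        - (switches T a + 2) * Real.log (2 * ℓ / α) ≤ Real.log (∑ i, u (T + 1) i) := by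
  have hℓ : (1 : ℝ) ≤ ℓ := Nat.one_le_cast.2 (NeZero.pos ℓ)
  have start_pos : 0 < ∑ j, u 1 j := sum_pos (fun i _ => h.weight_pos hη hα.le 1 i) univ_nonempty
  have hle := Real.log_le_log (by unfold guaranteedWeight; positivity)
    (h.shareRatio_mul_guaranteedWeight_le hη hα.le hα1 a T)
  rw [guaranteedWeight, Real.log_mul (by positivity) (by positivity),
    Real.log_mul (by positivity) start_pos.ne', Real.log_mul (by positivity) (Real.exp_pos _).ne',
    Real.log_exp, Real.log_pow, ← inv_div, Real.log_inv] at hle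
  have log_nonneg : 0 ≤ Real.log (2 * ℓ / α) :=
    Real.log_nonneg ((one_le_div hα).2 (by linarith))
  have switches_le : (switches (T + 1) a : ℝ) ≤ switches T a + 1 := by
    exact_mod_cast switches_succ_le T a
  nlinarith

theorem regret (h : IsShareRun η α G u) (hη : 0 ≤ η) (hα : 0 < α) (hα1 : α ≤ 1) (a : ℕ → Fin ℓ)
    {T : ℕ} (hG1 : ∀ t ≤ T, ∀ i, G t i ≤ 1) :
    (1 - α) * (1 - Real.exp (-η)) * ∑ t ∈ Icc 1 T, ∑ i, u t i / (∑ j, u t j) * G t i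
      ≤ η * ∑ t ∈ Icc 1 T, G t (a t) + (switches T a + 2) * Real.log (2 * ℓ / α) := by
  linarith [h.log_total_le hη hα.le hα1 hG1, h.log_total_ge hη hα hα1 a T]

end IsShareRun

/-! ### Expectations over the coins and the explored heuristics -/

lemma fromOne_update {A : Type*} [Inhabited A] {n : ℕ} (v : Fin n → A) (r : Fin n) (c : A) :
    fromOne (Function.update v r c) = Function.update (fromOne v) (r + 1) c := by
  funext t
  rcases t with _ | t
  · simp [fromOne, Function.update]
  · by_cases h : t = r
    · subst h
      simp [fromOne, fromZero]
    · rw [Function.update_of_ne (by omega)]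
      simp only [fromOne, fromZero]
      split_ifs with ht
      · rw [Function.update_of_ne (fun hr => h (congrArg Fin.val hr))]
      · rfl

lemma fromOne_of_notMem_Icc {A : Type*} [Inhabited A] {n : ℕ} (v : Fin n → A) {r : ℕ}
    (hr : r ∉ Icc 1 n) : fromOne v r = default := by
  rcases r with _ | r
  · rfl
  · rw [mem_Icc] at hr
    exact dif_neg (by omega)

section Expectation

variable {ℓ T n : ℕ} {ρ : ℝ} {G H : (ℕ → Bool) → (ℕ → Fin ℓ) → ℝ}

/-- The function `G` of the coins and of the explored heuristics does not depend on the coin at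
time `r`. -/
def IgnoresCoin (r : ℕ) (G : (ℕ → Bool) → (ℕ → Fin ℓ) → ℝ) : Prop :=
  ∀ b e c, G (Function.update b r c) e = G b e

/-- The probability of an outcome of a coin with parameter `ρ`. -/
def coinProb (ρ : ℝ) (c : Bool) : ℝ := if c then ρ else 1 - ρ

lemma coinProb_nonneg (hρ : ρ ∈ Set.Icc (0 : ℝ) 1) (c : Bool) : 0 ≤ coinProb ρ c := by
  rw [coinProb]
  split_ifs <;> linarith [hρ.1, hρ.2]

lemma sum_coinProb : ∑ c, coinProb ρ c = 1 := by simp [coinProb]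

variable [NeZero ℓ]

/-- The expectation over independent uniform heuristics explored at times `1, …, n`. -/
def exploredMean (n : ℕ) (G : (ℕ → Fin ℓ) → ℝ) : ℝ :=
  productMean (fun (_ : Fin n) (_ : Fin ℓ) => (1 / ℓ : ℝ)) fun e => G (fromOne e)

/-- The expectation over independent coins with parameter `ρ` at times `1, …, T` and independent
uniform heuristics explored at times `1, …, n`. -/
def coinExp (T n : ℕ) (ρ : ℝ) (G : (ℕ → Bool) → (ℕ → Fin ℓ) → ℝ) : ℝ :=
  productMean (fun (_ : Fin T) => coinProb ρ) fun β => exploredMean n (G (fromOne β))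

lemma sum_uniform : ∑ _i : Fin ℓ, (1 / ℓ : ℝ) = 1 := by
  simp [NeZero.ne ℓ]

lemma coinExp_mono (hρ : ρ ∈ Set.Icc (0 : ℝ) 1) (h : ∀ b e, G b e ≤ H b e) :
    coinExp T n ρ G ≤ coinExp T n ρ H :=
  productMean_mono (fun _ => coinProb_nonneg hρ) fun _ =>
    productMean_mono (fun _ _ => by positivity) fun _ => h _ _

lemma coinExp_add :
    coinExp T n ρ (fun b e => G b e + H b e) = coinExp T n ρ G + coinExp T n ρ H := by
  simp only [coinExp, exploredMean, productMean_add]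

lemma coinExp_mul (c : ℝ) : coinExp T n ρ (fun b e => c * G b e) = c * coinExp T n ρ G := by
  simp only [coinExp, exploredMean, productMean_mul]

lemma coinExp_sum {κ : Type*} (s : Finset κ) (K : κ → (ℕ → Bool) → (ℕ → Fin ℓ) → ℝ) :
    coinExp T n ρ (fun b e => ∑ k ∈ s, K k b e) = ∑ k ∈ s, coinExp T n ρ (K k) := by
  simp only [coinExp, exploredMean, productMean_sum]

lemma coinExp_const (c : ℝ) : coinExp (ℓ := ℓ) T n ρ (fun _ _ => c) = c := by
  simp only [coinExp, exploredMean, productMean_const fun _ => sum_uniform,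
    productMean_const fun _ => sum_coinProb]

lemma coinExp_nonneg (hρ : ρ ∈ Set.Icc (0 : ℝ) 1) (h : ∀ b e, 0 ≤ G b e) :
    0 ≤ coinExp T n ρ G :=
  (coinExp_const (T := T) (n := n) (ρ := ρ) 0).symm.trans_le (coinExp_mono hρ h)

lemma coinExp_ite_coin {r : ℕ} (hr : r ∈ Icc 1 T) (hG : IgnoresCoin r G) :
    coinExp T n ρ (fun b e => if b r then G b e else 0) = ρ * coinExp T n ρ G := by
  rw [mem_Icc] at hr
  obtain ⟨i, hi⟩ : ∃ i : Fin T, (i : ℕ) + 1 = r := ⟨⟨r - 1, by omega⟩, by simp only; omega⟩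
  have forget_coin (b : ℕ → Bool) (c : Bool) : G (Function.update b r c) = G b := funext (hG b · c)
  rw [coinExp, productMean_resample i sum_coinProb, coinExp, ← productMean_mul]
  congr 1
  funext β
  simp [fromOne_update, hi, forget_coin, coinProb, exploredMean, productMean]

lemma coinExp_ite_coin_le (hρ : ρ ∈ Set.Icc (0 : ℝ) 1) {r : ℕ} (hG0 : ∀ b e, 0 ≤ G b e)
    (hG : IgnoresCoin r G) :
    coinExp T n ρ (fun b e => if b r then G b e else 0) ≤ ρ * coinExp T n ρ G := by
  by_cases hr : r ∈ Icc 1 T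
  · exact (coinExp_ite_coin hr hG).le
  · have vanishes : coinExp T n ρ (fun b e => if b r then G b e else 0) = 0 := by
      simp [coinExp, exploredMean, productMean, fromOne_of_notMem_Icc _ hr]
    rw [vanishes]
    exact mul_nonneg hρ.1 (coinExp_nonneg hρ hG0)

lemma coinExp_ite_exists_coin_le (hρ : ρ ∈ Set.Icc (0 : ℝ) 1) {S : Finset ℕ}
    (hG0 : ∀ b e, 0 ≤ G b e) (hG : ∀ r ∈ S, IgnoresCoin r G) :
    coinExp T n ρ (fun b e => if ∃ r ∈ S, b r then G b e else 0)
      ≤ S.card * (ρ * coinExp T n ρ G) := by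
  have union_bound (b : ℕ → Bool) (e : ℕ → Fin ℓ) :
      (if ∃ r ∈ S, b r then G b e else 0) ≤ ∑ r ∈ S, if b r then G b e else 0 := by
    have term_nonneg : ∀ r ∈ S, 0 ≤ if b r then G b e else 0 := fun r _ => by
      split_ifs <;> simp [hG0]
    split_ifs with h
    · obtain ⟨r, hr, hb⟩ := h
      exact le_trans (by simp [hb]) (single_le_sum term_nonneg hr)
    · exact sum_nonneg term_nonneg
  refine (coinExp_mono hρ union_bound).trans ?_
  rw [coinExp_sum, ← nsmul_eq_mul]
  exact sum_le_card_nsmul _ _ _ fun r hr => coinExp_ite_coin_le hρ hG0 (hG r hr)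

lemma coinExp_explored {r : ℕ} (hr : r ∈ Icc 1 n) {K : (ℕ → Bool) → (ℕ → Fin ℓ) → Fin ℓ → ℝ}
    (hK : ∀ b e c, K b (Function.update e r c) = K b e) :
    coinExp T n ρ (fun b e => K b e (e r)) = 1 / ℓ * coinExp T n ρ (fun b e => ∑ i, K b e i) := by
  rw [mem_Icc] at hr
  obtain ⟨i, hi⟩ : ∃ i : Fin n, (i : ℕ) + 1 = r := ⟨⟨r - 1, by omega⟩, by simp only; omega⟩
  rw [← coinExp_mul, coinExp, coinExp]
  congr 1
  funext β
  rw [exploredMean, productMean_resample i sum_uniform]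
  simp only [fromOne_update, hi, hK, Function.update_self, ← mul_sum, exploredMean]

end Expectation

/-! ### The schedule of the exploration steps -/

section Countdown

variable {m : ℕ} {b : ℕ → Bool}

lemma exists_trigger {t : ℕ} (h : countdown m b t ≠ 0) :
    ∃ r < t, countdown m b r = 0 ∧ b r = true ∧ r + (m + 1) = t + countdown m b t := by
  induction t with
  | zero => exact absurd rfl h
  | succ t ih =>
    simp only [countdown] at h ⊢
    by_cases h0 : countdown m b t = 0
    · by_cases hb : b t = true
      · exact ⟨t, t.lt_succ_self, h0, hb, by simp only [h0, hb, if_true]; omega⟩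
      · simp [h0, hb] at h
    · obtain ⟨r, hr, idle, coin, time_eq⟩ := ih h0
      refine ⟨r, by omega, idle, coin, ?_⟩
      simp only [h0, if_false] at h ⊢
      omega

lemma countdown_le (t : ℕ) : countdown m b t ≤ m := by
  by_cases h : countdown m b t = 0
  · omega
  · obtain ⟨r, hr, -, -, time_eq⟩ := exists_trigger h
    omega

lemma exists_coin_of_countdown_ne_zero {t : ℕ} (h : countdown m b t ≠ 0) :
    ∃ r ∈ Ico (t - m) t, b r := by
  obtain ⟨r, hr, -, coin, time_eq⟩ := exists_trigger h
  have := countdown_le (m := m) (b := b) t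
  exact ⟨r, mem_Ico.2 ⟨by omega, hr⟩, coin⟩

lemma coin_of_countdown_eq_one {t : ℕ} (h : countdown m b t = 1) : b (t - m) = true := by
  obtain ⟨r, _, -, coin, time_eq⟩ := exists_trigger (t := t) (m := m) (b := b) (by omega)
  rwa [show t - m = r by omega]

lemma countdown_of_trigger {r j : ℕ} (h : countdown m b r = 0) (hb : b r = true) (hj : j < m) :
    countdown m b (r + j + 1) = m - j := by
  induction j with
  | zero => simp [countdown, h, hb]
  | succ j ih =>
    have ih := ih (by omega)
    rw [← Nat.add_assoc, countdown, ih, if_neg (by omega)]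
    omega

lemma countdown_add_of_trigger (hm : 1 ≤ m) {r : ℕ} (h : countdown m b r = 0)
    (hb : b r = true) : countdown m b (r + m) = 1 := by
  obtain ⟨j, rfl⟩ : ∃ j, m = j + 1 := ⟨m - 1, by omega⟩
  rw [← Nat.add_assoc, countdown_of_trigger h hb (by omega)]
  omega

lemma countdown_update {t r : ℕ} (h : t ≤ r) (c : Bool) :
    countdown m (Function.update b r c) t = countdown m b t := by
  induction t with
  | zero => rfl
  | succ t ih =>
    rw [countdown, countdown, ih (by omega), Function.update_of_ne (by omega)]

end Countdown

/-! ### The learning dynamics for fixed coins and explored heuristics -/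

lemma diameter_nonneg {M : Type*} [MetricSpace M] : 0 ≤ diameter M := Metric.diam_nonneg

namespace Input

variable {M : Type*} [MetricSpace M] {ℓ : ℕ} (I : Input M ℓ)

/-- The cost of heuristic `i` at time `t` as a real number. -/
def hcost (t : ℕ) (i : Fin ℓ) : ℝ := (I.heuristicCost t i).toReal

lemma hcost_nonneg (t : ℕ) (i : Fin ℓ) : 0 ≤ I.hcost t i := ENNReal.toReal_nonneg

lemma heuristicCost_le {t : ℕ} (ht : t ∈ Icc 1 I.T) (i : Fin ℓ) :
    I.heuristicCost t i ≤ ENNReal.ofReal (2 * diameter M) := by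
  rw [mem_Icc] at ht
  obtain ⟨s, rfl⟩ : ∃ s, t = s + 1 := ⟨t - 1, by omega⟩
  exact I.step_le s (by omega) i

lemma ofReal_hcost {t : ℕ} (ht : t ∈ Icc 1 I.T) (i : Fin ℓ) :
    ENNReal.ofReal (I.hcost t i) = I.heuristicCost t i :=
  ENNReal.ofReal_toReal (ne_top_of_le_ne_top ENNReal.ofReal_ne_top (I.heuristicCost_le ht i))

lemma hcost_le {t : ℕ} (ht : t ∈ Icc 1 I.T) (i : Fin ℓ) : I.hcost t i ≤ 2 * diameter M :=
  ENNReal.toReal_le_of_le_ofReal (mul_nonneg zero_le_two diameter_nonneg) (I.heuristicCost_le ht i)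

/-- The loss vector of step `t`; it vanishes unless `t` is an exploration step. -/
def loss (m : ℕ) (b : ℕ → Bool) (e : ℕ → Fin ℓ) (t : ℕ) : Fin ℓ → ℝ :=
  if countdown m b t = 1 then I.feedback e t else fun _ => 0

variable {m : ℕ} {η α : ℝ} {b : ℕ → Bool} {e : ℕ → Fin ℓ}

lemma loss_apply (t : ℕ) (i : Fin ℓ) : I.loss m b e t i =
    if countdown m b t = 1 then (if i = e t then I.hcost t i / (2 * diameter M) else 0) else 0 := by
  by_cases h : countdown m b t = 1 <;> by_cases hi : i = e t <;> simp [loss, feedback, hcost, h, hi]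

lemma loss_nonneg (t : ℕ) (i : Fin ℓ) : 0 ≤ I.loss m b e t i := by
  have := I.hcost_nonneg t i
  have := diameter_nonneg (M := M)
  rw [loss_apply]
  split_ifs <;> positivity

lemma loss_le_one {t : ℕ} (ht : t ≤ I.T) (i : Fin ℓ) : I.loss m b e t i ≤ 1 := by
  rw [loss_apply]
  split_ifs with h
  · have : t ≠ 0 := by rintro rfl; simp [countdown] at h
    exact div_le_one_of_le₀ (I.hcost_le (mem_Icc.2 ⟨by omega, ht⟩) i)
      (mul_nonneg zero_le_two diameter_nonneg)
  · exact zero_le_one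
  · exact zero_le_one

lemma isShareRun_weights : IsShareRun η α (I.loss m b e) (I.weights m η α b e) where
  loss_nonneg := I.loss_nonneg
  start_pos := by simp [weights]
  succ t := by
    rw [weights, loss]
    split_ifs
    · rfl
    · rw [shareUpdate_zero]

lemma weights_update_coin {t r : ℕ} (h : t ≤ r) (c : Bool) :
    I.weights m η α (Function.update b r c) e t = I.weights m η α b e t := by
  induction t with
  | zero => rfl
  | succ t ih => rw [weights, weights, ih (by omega), countdown_update (by omega)]

lemma weights_update_explored {t r : ℕ} (h : t ≤ r) (i : Fin ℓ) :
    I.weights m η α b (Function.update e r i) t = I.weights m η α b e t := by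
  induction t with
  | zero => rfl
  | succ t ih =>
    have feedback_eq : I.feedback (Function.update e r i) t = I.feedback e t := by
      funext j
      simp only [feedback, Function.update_of_ne (show t ≠ r by omega)]
    rw [weights, weights, ih (by omega), feedback_eq]

lemma weights_of_trigger {r j : ℕ} (h : countdown m b r = 0) (hb : b r = true) (hj : j ≤ m) :
    I.weights m η α b e (r + j) = I.weights m η α b e r := by
  induction j with
  | zero => rfl
  | succ j ih =>
    rw [← Nat.add_assoc, weights, if_neg, ih (by omega)]
    rcases j with _ | j
    · simp [h]
    · rw [← Nat.add_assoc, countdown_of_trigger h hb (by omega)]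
      omega

lemma fractional_update_coin {t r : ℕ} (h : t ≤ r) (c : Bool) :
    I.fractional m η α (Function.update b r c) e t = I.fractional m η α b e t := by
  unfold fractional
  rw [I.weights_update_coin h]

lemma fractional_update_explored {t r : ℕ} (h : t ≤ r) (i : Fin ℓ) :
    I.fractional m η α b (Function.update e r i) t = I.fractional m η α b e t := by
  unfold fractional
  rw [I.weights_update_explored h]

lemma fractional_of_trigger {r : ℕ} (h : countdown m b r = 0) (hb : b r = true) :
    I.fractional m η α b e (r + m) = I.fractional m η α b e r := by
  unfold fractional
  rw [I.weights_of_trigger h hb le_rfl]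

lemma weights_pos (hη : 0 ≤ η) (hα : 0 ≤ α) (t : ℕ) (i : Fin ℓ) : 0 < I.weights m η α b e t i :=
  I.isShareRun_weights.weight_pos hη hα t i

variable [NeZero ℓ]

lemma sum_weights_pos (hη : 0 ≤ η) (hα : 0 ≤ α) (t : ℕ) : 0 < ∑ i, I.weights m η α b e t i :=
  sum_pos (fun i _ => I.weights_pos hη hα t i) univ_nonempty

lemma fractional_pos (hη : 0 ≤ η) (hα : 0 ≤ α) (t : ℕ) (i : Fin ℓ) :
    0 < I.fractional m η α b e t i :=
  div_pos (I.weights_pos hη hα t i) (I.sum_weights_pos hη hα t)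

lemma sum_fractional (hη : 0 ≤ η) (hα : 0 ≤ α) (t : ℕ) : ∑ i, I.fractional m η α b e t i = 1 := by
  simp only [fractional]
  rw [← sum_div, div_self (I.sum_weights_pos hη hα t).ne']

lemma moved_fractional_le (hη : 0 ≤ η) (hα : 0 ≤ α) (hα1 : α ≤ 1) (t : ℕ) :
    moved (I.fractional m η α b e t) (I.fractional m η α b e (t + 1))
      ≤ η * ∑ i, I.fractional m η α b e t i * I.loss m b e t i := by
  unfold fractional
  rw [I.isShareRun_weights.succ]
  exact moved_shareUpdate_le hη hα hα1 (I.loss_nonneg t) (I.weights_pos hη hα t)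

lemma regret (hη : 0 ≤ η) (hα : 0 < α) (hα1 : α ≤ 1) (a : ℕ → Fin ℓ) :
    (1 - α) * (1 - Real.exp (-η)) *
        ∑ t ∈ Icc 1 I.T, ∑ i, I.fractional m η α b e t i * I.loss m b e t i
      ≤ η * ∑ t ∈ Icc 1 I.T, I.loss m b e t (a t)
        + (switches I.T a + 2) * Real.log (2 * ℓ / α) :=
  I.isShareRun_weights.regret hη hα hα1 a fun _ => I.loss_le_one

end Input

/-! ### The expected cost of the fractional solution -/

lemma sum_Icc_one_eq_sum_range {A : Type*} [AddCommMonoid A] (f : ℕ → A) (T : ℕ) :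
    ∑ t ∈ Icc 1 T, f t = ∑ t ∈ range T, f (t + 1) := by
  rw [range_eq_Ico, sum_Ico_add' f 0 T 1]
  rfl

lemma sum_window_le {f : ℕ → ℝ} (hf : ∀ u, 0 ≤ f u) (T w : ℕ) :
    ∑ t ∈ Icc 1 T, ∑ u ∈ Ioc (t - w) t, f u ≤ w * ∑ u ∈ Icc 1 T, f u := by
  rw [sum_comm' (t' := Icc 1 T) (s' := fun u => (Icc 1 T).filter fun t => u ∈ Ioc (t - w) t)
    (fun t u => by simp only [mem_Icc, mem_Ioc, mem_filter]; omega), mul_sum]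
  refine sum_le_sum fun u _ => ?_
  rw [sum_const, nsmul_eq_mul]
  have window_subset : (Icc 1 T).filter (fun t => u ∈ Ioc (t - w) t) ⊆ Ico u (u + w) := fun t => by
    simp only [mem_Icc, mem_Ioc, mem_filter, mem_Ico]
    omega
  have card_le := card_le_card window_subset
  rw [Nat.card_Ico, Nat.add_sub_cancel_left] at card_le
  exact mul_le_mul_of_nonneg_right (Nat.cast_le.2 card_le) (hf u)

lemma sum_ite_le_startup {c : ℝ} (hc : 0 ≤ c) (T m : ℕ) :
    ∑ t ∈ Icc 1 T, (if t ≤ m then c else 0) ≤ m * c := by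
  rw [← sum_filter, sum_const, nsmul_eq_mul]
  have startup_subset : (Icc 1 T).filter (· ≤ m) ⊆ Icc 1 m := fun t => by
    simp only [mem_filter, mem_Icc]
    omega
  have card_le := card_le_card startup_subset
  rw [Nat.card_Icc, Nat.add_sub_cancel] at card_le
  exact mul_le_mul_of_nonneg_right (Nat.cast_le.2 card_le) hc

/-- Indicator of the event that one of the last `2 * m` coins triggers an exploration. -/
def recentCoin (m : ℕ) (b : ℕ → Bool) (t : ℕ) : ℝ :=
  if ∃ r ∈ Ico (t - (2 : ℕ) * m) t, b r then 1 else 0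

namespace Input

variable {M : Type*} [MetricSpace M] {ℓ : ℕ} (I : Input M ℓ) (m : ℕ) (η α : ℝ)

/-- The cost at time `t` of the fractional solution of time `s`. -/
def staleCost (s t : ℕ) (b : ℕ → Bool) (e : ℕ → Fin ℓ) : ℝ :=
  ∑ i, I.fractional m η α b e s i * I.hcost t i

/-- The mass moved by the fractional solution at time `u`. -/
def movement (u : ℕ) (b : ℕ → Bool) (e : ℕ → Fin ℓ) : ℝ :=
  moved (I.fractional m η α b e (u - 1)) (I.fractional m η α b e u)

/-- The mass moved by the fractional solution at the last `2 * m` times. -/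
def recentMovement (t : ℕ) (b : ℕ → Bool) (e : ℕ → Fin ℓ) : ℝ :=
  ∑ u ∈ Ioc (t - 2 * m) t, I.movement m η α u b e

/-- The cost of the fractional solution at time `t` if `t` is an exploration step. -/
def exploreCost (t : ℕ) (b : ℕ → Bool) (e : ℕ → Fin ℓ) : ℝ :=
  if countdown m b t = 1 then I.staleCost m η α t t b e else 0

variable {m η α} {b : ℕ → Bool} {e : ℕ → Fin ℓ}

lemma exploreCost_zero : I.exploreCost m η α 0 = fun _ _ => 0 := by
  funext b e
  simp [exploreCost, countdown]

lemma movement_nonneg (u : ℕ) : 0 ≤ I.movement m η α u b e := moved_nonneg _ _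

lemma recentMovement_nonneg (t : ℕ) : 0 ≤ I.recentMovement m η α t b e :=
  sum_nonneg fun u _ => I.movement_nonneg u

lemma ignoresCoin_staleCost {s r : ℕ} (h : s ≤ r) (t : ℕ) :
    IgnoresCoin r (I.staleCost m η α s t) := fun b e c => by
  unfold staleCost
  rw [I.fractional_update_coin h]

lemma ignoresCoin_movement {u r : ℕ} (h : u ≤ r) : IgnoresCoin r (I.movement m η α u) :=
  fun b e c => by
    unfold movement
    rw [I.fractional_update_coin h, I.fractional_update_coin (by omega)]

lemma moved_le_recentMovement {s s' t : ℕ} (h1 : t - 2 * m ≤ s) (h2 : s ≤ s') (h3 : s' ≤ t) :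
    moved (I.fractional m η α b e s) (I.fractional m η α b e s') ≤ I.recentMovement m η α t b e :=
  (moved_le_sum_moved (fun t => I.fractional m η α b e t) h2).trans
    (sum_le_sum_of_subset_of_nonneg (Ioc_subset_Ioc h1 h3) fun u _ _ => I.movement_nonneg u)

lemma staleCost_le_later {t : ℕ} (ht : t ∈ Icc 1 I.T) {s s' : ℕ} (h1 : t - 2 * m ≤ s)
    (h2 : s ≤ s') (h3 : s' ≤ t) : I.staleCost m η α s t b e
      ≤ I.staleCost m η α s' t b e + 2 * diameter M * I.recentMovement m η α t b e := by
  have := diameter_nonneg (M := M)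
  refine (sum_mul_le_add_moved (p' := I.fractional m η α b e s')
    (I.hcost_nonneg t) (I.hcost_le ht)).trans ?_
  unfold staleCost
  gcongr
  exact I.moved_le_recentMovement h1 h2 h3

variable [NeZero ℓ]

section Pointwise

variable (hη : 0 ≤ η) (hα : 0 ≤ α)
include hη hα

lemma staleCost_nonneg (s t : ℕ) : 0 ≤ I.staleCost m η α s t b e :=
  sum_nonneg fun i _ => mul_nonneg (I.fractional_pos hη hα s i).le (I.hcost_nonneg t i)

lemma staleCost_le {t : ℕ} (ht : t ∈ Icc 1 I.T) (s : ℕ) :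
    I.staleCost m η α s t b e ≤ 2 * diameter M := by
  calc I.staleCost m η α s t b e
      ≤ ∑ i, I.fractional m η α b e s i * (2 * diameter M) :=
        sum_le_sum fun i _ =>
          mul_le_mul_of_nonneg_left (I.hcost_le ht i) (I.fractional_pos hη hα s i).le
    _ = 2 * diameter M := by rw [← sum_mul, I.sum_fractional hη hα, one_mul]

lemma staleCost_le_earlier {t : ℕ} (ht : t ∈ Icc 1 I.T) {s : ℕ} (h1 : t - 2 * m ≤ s)
    (h2 : s ≤ t) : I.staleCost m η α t t b e
      ≤ I.staleCost m η α s t b e + 2 * diameter M * I.recentMovement m η α t b e := by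
  have := diameter_nonneg (M := M)
  refine (sum_mul_le_add_moved (p' := I.fractional m η α b e s)
    (I.hcost_nonneg t) (I.hcost_le ht)).trans ?_
  rw [moved_comm (by rw [I.sum_fractional hη hα, I.sum_fractional hη hα])]
  unfold staleCost
  gcongr
  exact I.moved_le_recentMovement h1 h2 le_rfl

lemma exploreCost_nonneg (t : ℕ) : 0 ≤ I.exploreCost m η α t b e := by
  unfold exploreCost
  split_ifs
  · exact I.staleCost_nonneg hη hα t t
  · exact le_rfl

end Pointwise

section Expectation

variable {n : ℕ} {ρ : ℝ}

/-- Only a `1 / ℓ` fraction of the exploration cost is seen, since one heuristic is explored. -/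
lemma coinExp_fractional_loss (hD : 0 < diameter M) {t : ℕ} (ht : t ≤ n) :
    2 * diameter M * ℓ *
        coinExp I.T n ρ (fun b e => ∑ i, I.fractional m η α b e t i * I.loss m b e t i)
      = coinExp I.T n ρ (I.exploreCost m η α t) := by
  rcases t.eq_zero_or_pos with rfl | ht0
  · simp [exploreCost_zero, loss, countdown, coinExp_const]
  have hℓ : (ℓ : ℝ) ≠ 0 := Nat.cast_ne_zero.2 (NeZero.ne ℓ)
  have loss_at_explored (b : ℕ → Bool) (e : ℕ → Fin ℓ) :
      ∑ i, I.fractional m η α b e t i * I.loss m b e t i = if countdown m b t = 1 then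
        I.fractional m η α b e t (e t) * (I.hcost t (e t) / (2 * diameter M)) else 0 := by
    simp only [loss_apply]
    split_ifs <;> simp
  simp only [loss_at_explored]
  rw [coinExp_explored (mem_Icc.2 ⟨ht0, ht⟩) (K := fun b e i => if countdown m b t = 1 then
      I.fractional m η α b e t i * (I.hcost t i / (2 * diameter M)) else 0)
      (fun b e c => by funext i; rw [I.fractional_update_explored le_rfl]),
    ← coinExp_mul, ← coinExp_mul]
  congr 1
  funext b e
  unfold exploreCost staleCost
  split_ifs
  · simp only [mul_sum]
    refine sum_congr rfl fun i _ => ?_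
    field_simp
  · simp

lemma coinExp_loss_le (hD : 0 < diameter M) (hρ : ρ ∈ Set.Icc (0 : ℝ) 1) {t : ℕ}
    (ht : t ∈ Icc 1 n) (j : Fin ℓ) :
    2 * diameter M * ℓ * coinExp I.T n ρ (fun b e => I.loss m b e t j) ≤ ρ * I.hcost t j := by
  have hℓ : (ℓ : ℝ) ≠ 0 := Nat.cast_ne_zero.2 (NeZero.ne ℓ)
  set c := I.hcost t j / (2 * diameter M)
  have hc : 0 ≤ c := div_nonneg (I.hcost_nonneg t j) (by positivity)
  have coin_of_explore (b : ℕ → Bool) :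
      ∑ i, (if countdown m b t = 1 then (if j = i then c else 0) else 0)
        ≤ if b (t - m) then c else 0 := by
    by_cases h : countdown m b t = 1
    · simp [h, coin_of_countdown_eq_one h]
    · simp only [h, if_false, sum_const_zero]
      split_ifs <;> simp [hc]
  have key : coinExp (ℓ := ℓ) I.T n ρ (fun b _ =>
      ∑ i, if countdown m b t = 1 then (if j = i then c else 0) else 0) ≤ ρ * c := by
    refine (coinExp_mono hρ fun b _ => coin_of_explore b).trans ?_
    exact (coinExp_ite_coin_le hρ (fun _ _ => hc) fun _ _ _ => rfl).trans_eq (by rw [coinExp_const])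
  simp only [loss_apply]
  rw [coinExp_explored ht (K := fun b _ i =>
    if countdown m b t = 1 then (if j = i then I.hcost t j / (2 * diameter M) else 0) else 0)
    fun _ _ _ => rfl]
  calc 2 * diameter M * ℓ * (1 / ℓ * coinExp (ℓ := ℓ) I.T n ρ (fun b _ =>
        ∑ i, if countdown m b t = 1 then (if j = i then c else 0) else 0))
      ≤ 2 * diameter M * ℓ * (1 / ℓ * (ρ * c)) := by gcongr
    _ = ρ * I.hcost t j := by simp only [c]; field_simp

variable (hη : 0 ≤ η) (hα : 0 ≤ α) (hρ : ρ ∈ Set.Icc (0 : ℝ) 1)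
include hη hα hρ

lemma coinExp_movement_le (hD : 0 < diameter M) (hα1 : α ≤ 1) {t : ℕ} (ht : t ≤ n) :
    2 * diameter M * ℓ * coinExp I.T n ρ (I.movement m η α (t + 1))
      ≤ η * coinExp I.T n ρ (I.exploreCost m η α t) := by
  rw [← I.coinExp_fractional_loss hD ht, mul_left_comm]
  refine mul_le_mul_of_nonneg_left ?_ (by positivity)
  rw [← coinExp_mul]
  exact coinExp_mono hρ fun b e => I.moved_fractional_le hη hα hα1 t

lemma coinExp_recentCoin_mul_le {t : ℕ} (ht : t ∈ Icc 1 I.T) :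
    coinExp I.T n ρ (fun b e => recentCoin m b t * I.staleCost m η α t t b e)
      ≤ 2 * m * ρ * coinExp I.T n ρ (I.staleCost m η α t t)
        + 2 * diameter M * (1 + 2 * m * ρ) * coinExp I.T n ρ (I.recentMovement m η α t) := by
  set s := t - 2 * m
  set R := coinExp I.T n ρ (I.recentMovement m η α t)
  have shift_back (b : ℕ → Bool) (e : ℕ → Fin ℓ) :
      recentCoin m b t * I.staleCost m η α t t b e
        ≤ (if ∃ r ∈ Ico s t, b r then I.staleCost m η α s t b e else 0)
          + 2 * diameter M * I.recentMovement m η α t b e := by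
    have := diameter_nonneg (M := M)
    have := I.recentMovement_nonneg (m := m) (η := η) (α := α) (b := b) (e := e) t
    have := I.staleCost_le_earlier hη hα ht (m := m) (b := b) (e := e) le_rfl (Nat.sub_le t _)
    unfold recentCoin
    split_ifs
    · rwa [one_mul]
    · rw [zero_mul, zero_add]
      positivity
  have shift_forth : coinExp I.T n ρ (I.staleCost m η α s t)
      ≤ coinExp I.T n ρ (I.staleCost m η α t t) + 2 * diameter M * R := by
    rw [← coinExp_mul, ← coinExp_add]
    exact coinExp_mono hρ fun b e => I.staleCost_le_later ht le_rfl (Nat.sub_le t _) le_rfl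
  have stale_nonneg : 0 ≤ coinExp I.T n ρ (I.staleCost m η α s t) :=
    coinExp_nonneg hρ fun b e => I.staleCost_nonneg hη hα s t
  have card_le : ((Ico s t).card : ℝ) ≤ 2 * m := by
    rw [Nat.card_Ico]
    exact_mod_cast (by omega : t - s ≤ 2 * m)
  have hρ0 := hρ.1
  calc coinExp I.T n ρ (fun b e => recentCoin m b t * I.staleCost m η α t t b e)
      ≤ (Ico s t).card * (ρ * coinExp I.T n ρ (I.staleCost m η α s t)) + 2 * diameter M * R := by
        refine (coinExp_mono hρ shift_back).trans ?_
        rw [coinExp_add, coinExp_mul]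
        exact add_le_add_left (coinExp_ite_exists_coin_le hρ
          (fun b e => I.staleCost_nonneg hη hα s t)
          fun r hr => I.ignoresCoin_staleCost (mem_Ico.1 hr).1 t) _
    _ ≤ 2 * m * (ρ * (coinExp I.T n ρ (I.staleCost m η α t t) + 2 * diameter M * R))
          + 2 * diameter M * R := by gcongr
    _ = _ := by ring

/-- An idle time `v` starts an exploration step at time `v + m` with probability `ρ`, up to which
the fractional solution does not move. -/
lemma mul_coinExp_idle_le (hm : 1 ≤ m) {v : ℕ} (hv : v ∈ Icc 1 I.T) :
    ρ * coinExp I.T n ρ (fun b e =>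
        if countdown m b v = 0 then I.staleCost m η α v (v + m) b e else 0)
      ≤ coinExp I.T n ρ (I.exploreCost m η α (v + m)) := by
  rw [← coinExp_ite_coin hv fun b e c => by
    simp only [countdown_update le_rfl, I.ignoresCoin_staleCost le_rfl (v + m) b e c]]
  refine coinExp_mono hρ fun b e => ?_
  have explore_nonneg := I.exploreCost_nonneg (m := m) (b := b) (e := e) hη hα (v + m)
  split_ifs with coin idle
  · rw [exploreCost, if_pos (countdown_add_of_trigger hm idle coin), staleCost, staleCost,
      I.fractional_of_trigger idle coin]
  · exact explore_nonneg
  · exact explore_nonneg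

lemma coinExp_staleCost_le_idle {v : ℕ} (hv : v + m ∈ Icc 1 I.T) :
    (1 - ρ * m) * coinExp I.T n ρ (I.staleCost m η α (v - m) (v + m))
      ≤ coinExp I.T n ρ (fun b e =>
          if countdown m b v = 0 then I.staleCost m η α v (v + m) b e else 0)
        + 2 * diameter M * coinExp I.T n ρ (I.recentMovement m η α (v + m)) := by
  set t := v + m
  set s := v - m
  have stale_nonneg (b : ℕ → Bool) (e : ℕ → Fin ℓ) : 0 ≤ I.staleCost m η α s t b e :=
    I.staleCost_nonneg hη hα s t
  have idle_or_coin (b : ℕ → Bool) (e : ℕ → Fin ℓ) : I.staleCost m η α s t b e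
      ≤ (if countdown m b v = 0 then I.staleCost m η α v t b e else 0)
        + (if ∃ r ∈ Ico s v, b r then I.staleCost m η α s t b e else 0)
        + 2 * diameter M * I.recentMovement m η α t b e := by
    have shift : 0 ≤ 2 * diameter M * I.recentMovement m η α t b e :=
      mul_nonneg (mul_nonneg zero_le_two diameter_nonneg) (I.recentMovement_nonneg t)
    by_cases idle : countdown m b v = 0
    · have later := I.staleCost_le_later (m := m) (η := η) (α := α) (b := b) (e := e) (s := s)
        (s' := v) hv (by omega) (by omega) (by omega)
      have := stale_nonneg b e
      rw [if_pos idle]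
      split_ifs <;> linarith
    · rw [if_neg idle, if_pos (exists_coin_of_countdown_ne_zero idle)]
      linarith
  have union_bound := coinExp_ite_exists_coin_le (T := I.T) (n := n) hρ stale_nonneg
    fun r (hr : r ∈ Ico s v) => I.ignoresCoin_staleCost (mem_Ico.1 hr).1 t
  have card_mul_le : ((Ico s v).card : ℝ) * (ρ * coinExp I.T n ρ (I.staleCost m η α s t))
      ≤ m * (ρ * coinExp I.T n ρ (I.staleCost m η α s t)) := by
    refine mul_le_mul_of_nonneg_right ?_ (mul_nonneg hρ.1 (coinExp_nonneg hρ stale_nonneg))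
    rw [Nat.card_Ico]
    exact_mod_cast (by omega : v - s ≤ m)
  have h := coinExp_mono (T := I.T) (n := n) hρ idle_or_coin
  rw [coinExp_add, coinExp_mul, coinExp_add] at h
  linarith

lemma coinExp_exploreCost_ge (hρm : ρ * m ≤ 1) (hm : 1 ≤ m) {t : ℕ} (ht : t ∈ Icc (m + 1) I.T) :
    ρ * (1 - ρ * m) * coinExp I.T n ρ (I.staleCost m η α t t)
      ≤ coinExp I.T n ρ (I.exploreCost m η α t)
        + 4 * diameter M * ρ * coinExp I.T n ρ (I.recentMovement m η α t) := by
  rw [mem_Icc] at ht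
  obtain ⟨v, rfl⟩ : ∃ v, t = v + m := ⟨t - m, by omega⟩
  have ht' : v + m ∈ Icc 1 I.T := mem_Icc.2 ⟨by omega, ht.2⟩
  have idle := I.coinExp_staleCost_le_idle (n := n) hη hα hρ ht'
  have explored := I.mul_coinExp_idle_le (n := n) hη hα hρ hm (v := v)
    (mem_Icc.2 ⟨by omega, by omega⟩)
  have earlier : coinExp I.T n ρ (I.staleCost m η α (v + m) (v + m))
      ≤ coinExp I.T n ρ (I.staleCost m η α (v - m) (v + m))
        + 2 * diameter M * coinExp I.T n ρ (I.recentMovement m η α (v + m)) := by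
    rw [← coinExp_mul, ← coinExp_add]
    exact coinExp_mono hρ fun b e =>
      I.staleCost_le_earlier hη hα ht' (by omega) (by omega)
  set R := coinExp I.T n ρ (I.recentMovement m η α (v + m))
  have hR : 0 ≤ 2 * diameter M * R := mul_nonneg (mul_nonneg zero_le_two diameter_nonneg)
    (coinExp_nonneg hρ fun b e => I.recentMovement_nonneg (v + m))
  have hρm0 : 0 ≤ ρ * m := mul_nonneg hρ.1 m.cast_nonneg
  nlinarith [mul_le_mul_of_nonneg_left earlier (mul_nonneg hρ.1 (sub_nonneg.2 hρm)),
    mul_le_mul_of_nonneg_left idle hρ.1, mul_nonneg hρ.1 (mul_nonneg hρm0 hR)]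

end Expectation

end Input

namespace Input

variable {M : Type*} [MetricSpace M] {ℓ : ℕ} [NeZero ℓ] (I : Input M ℓ) (m : ℕ) (η α ρ : ℝ)

/-- The expected total cost of the fractional solution. -/
def fractionalTotal : ℝ := ∑ t ∈ Icc 1 I.T, coinExp I.T (I.T + m) ρ (I.staleCost m η α t t)

/-- The expected total cost of the fractional solution in exploration steps. -/
def exploredTotal : ℝ := ∑ t ∈ Icc 1 I.T, coinExp I.T (I.T + m) ρ (I.exploreCost m η α t)

/-- The expected total movement of the fractional solution. -/
def movementTotal : ℝ := ∑ t ∈ Icc 1 I.T, coinExp I.T (I.T + m) ρ (I.movement m η α t)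

variable {m η α ρ} (hρ : ρ ∈ Set.Icc (0 : ℝ) 1)
include hρ

lemma movementTotal_nonneg : 0 ≤ I.movementTotal m η α ρ :=
  sum_nonneg fun t _ => coinExp_nonneg hρ fun _ _ => I.movement_nonneg t

lemma sum_coinExp_recentMovement_le :
    ∑ t ∈ Icc 1 I.T, coinExp I.T (I.T + m) ρ (I.recentMovement m η α t)
      ≤ 2 * m * I.movementTotal m η α ρ := by
  have h := sum_window_le (f := fun u => coinExp I.T (I.T + m) ρ (I.movement m η α u))
    (fun u => coinExp_nonneg hρ fun _ _ => I.movement_nonneg u) I.T (2 * m)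
  have window (t : ℕ) : coinExp I.T (I.T + m) ρ (I.recentMovement m η α t)
      = ∑ u ∈ Ioc (t - 2 * m) t, coinExp I.T (I.T + m) ρ (I.movement m η α u) := coinExp_sum _ _
  push_cast at h
  simpa only [window, movementTotal] using h

variable (hη : 0 ≤ η)
include hη

lemma exploredTotal_le (hD : 0 < diameter M) (hα : 0 < α) (hα1 : α ≤ 1) (a : ℕ → Fin ℓ) :
    (1 - α) * (1 - Real.exp (-η)) * I.exploredTotal m η α ρ
      ≤ η * ρ * ∑ t ∈ Icc 1 I.T, I.hcost t (a t)
        + 2 * diameter M * ℓ * ((switches I.T a + 2) * Real.log (2 * ℓ / α)) := by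
  have expected_regret := coinExp_mono (T := I.T) (n := I.T + m) hρ fun b e =>
    I.regret (b := b) (e := e) (m := m) hη hα hα1 a
  rw [coinExp_mul, coinExp_add, coinExp_mul, coinExp_const, coinExp_sum, coinExp_sum]
    at expected_regret
  have explored : I.exploredTotal m η α ρ = 2 * diameter M * ℓ * ∑ t ∈ Icc 1 I.T,
      coinExp I.T (I.T + m) ρ fun b e => ∑ i, I.fractional m η α b e t i * I.loss m b e t i := by
    rw [exploredTotal, mul_sum]
    refine sum_congr rfl fun t ht => (I.coinExp_fractional_loss hD ?_).symm
    have := (mem_Icc.1 ht).2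
    omega
  have benchmark : 2 * diameter M * ℓ * ∑ t ∈ Icc 1 I.T,
      coinExp I.T (I.T + m) ρ (fun b e => I.loss m b e t (a t))
        ≤ ρ * ∑ t ∈ Icc 1 I.T, I.hcost t (a t) := by
    rw [mul_sum, mul_sum]
    refine sum_le_sum fun t ht => I.coinExp_loss_le hD hρ ?_ _
    exact Icc_subset_Icc le_rfl (Nat.le_add_right _ _) ht
  rw [explored]
  have hDℓ : 0 ≤ 2 * diameter M * ℓ := by positivity
  linarith [mul_le_mul_of_nonneg_left expected_regret hDℓ, mul_le_mul_of_nonneg_left benchmark hη]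

variable (hα : 0 ≤ α)
include hα

lemma exploredTotal_nonneg : 0 ≤ I.exploredTotal m η α ρ :=
  sum_nonneg fun t _ => coinExp_nonneg hρ fun _ _ => I.exploreCost_nonneg hη hα t

lemma fractionalTotal_nonneg : 0 ≤ I.fractionalTotal m η α ρ :=
  sum_nonneg fun t _ => coinExp_nonneg hρ fun _ _ => I.staleCost_nonneg hη hα t t

lemma movementTotal_le (hD : 0 < diameter M) (hα1 : α ≤ 1) :
    2 * diameter M * ℓ * I.movementTotal m η α ρ ≤ η * I.exploredTotal m η α ρ := by
  have explore_nonneg (t : ℕ) : 0 ≤ coinExp I.T (I.T + m) ρ (I.exploreCost m η α t) :=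
    coinExp_nonneg hρ fun b e => I.exploreCost_nonneg hη hα t
  rw [movementTotal, exploredTotal, sum_Icc_one_eq_sum_range, mul_sum, mul_sum]
  calc ∑ t ∈ range I.T, 2 * diameter M * ℓ * coinExp I.T (I.T + m) ρ (I.movement m η α (t + 1))
      ≤ ∑ t ∈ range I.T, η * coinExp I.T (I.T + m) ρ (I.exploreCost m η α t) :=
        sum_le_sum fun t ht => I.coinExp_movement_le hη hα hρ hD hα1 (by
          have := mem_range.1 ht
          omega)
    _ ≤ ∑ t ∈ range (I.T + 1), η * coinExp I.T (I.T + m) ρ (I.exploreCost m η α t) := by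
        rw [sum_range_succ]
        exact le_add_of_nonneg_right (mul_nonneg hη (explore_nonneg _))
    _ = ∑ t ∈ Icc 1 I.T, η * coinExp I.T (I.T + m) ρ (I.exploreCost m η α t) := by
        rw [sum_range_succ', I.exploreCost_zero, coinExp_const, mul_zero, add_zero,
          sum_Icc_one_eq_sum_range]

lemma sum_coinExp_recentCoin_mul_le :
    ∑ t ∈ Icc 1 I.T,
        coinExp I.T (I.T + m) ρ (fun b e => recentCoin m b t * I.staleCost m η α t t b e)
      ≤ 2 * m * ρ * I.fractionalTotal m η α ρ
        + 4 * diameter M * m * (1 + 2 * m * ρ) * I.movementTotal m η α ρ := by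
  have stepwise := sum_le_sum fun t ht => I.coinExp_recentCoin_mul_le (n := I.T + m) (m := m)
    hη hα hρ (t := t) ht
  rw [sum_add_distrib, ← mul_sum, ← mul_sum] at stepwise
  have recent := I.sum_coinExp_recentMovement_le (m := m) (η := η) (α := α) hρ
  have factor_nonneg : 0 ≤ 2 * diameter M * (1 + 2 * m * ρ) := by
    have := diameter_nonneg (M := M)
    have := hρ.1
    positivity
  rw [fractionalTotal]
  linarith [mul_le_mul_of_nonneg_left recent factor_nonneg]

lemma mul_fractionalTotal_le (hρm : ρ * m ≤ 1) (hm : 1 ≤ m) :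
    ρ * (1 - ρ * m) * I.fractionalTotal m η α ρ
      ≤ I.exploredTotal m η α ρ + 8 * diameter M * m * ρ * I.movementTotal m η α ρ
        + ρ * (2 * diameter M * m) := by
  have hD := diameter_nonneg (M := M)
  have hρ0 := hρ.1
  have explore_nonneg (t : ℕ) : 0 ≤ coinExp I.T (I.T + m) ρ (I.exploreCost m η α t) :=
    coinExp_nonneg hρ fun b e => I.exploreCost_nonneg hη hα t
  have recent_nonneg (t : ℕ) : 0 ≤ coinExp I.T (I.T + m) ρ (I.recentMovement m η α t) :=
    coinExp_nonneg hρ fun b e => I.recentMovement_nonneg t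
  have stepwise : ∀ t ∈ Icc 1 I.T,
      ρ * (1 - ρ * m) * coinExp I.T (I.T + m) ρ (I.staleCost m η α t t)
        ≤ coinExp I.T (I.T + m) ρ (I.exploreCost m η α t)
          + 4 * diameter M * ρ * coinExp I.T (I.T + m) ρ (I.recentMovement m η α t)
          + if t ≤ m then ρ * (2 * diameter M) else 0 := by
    intro t ht
    split_ifs with startup
    · have stale_le : coinExp I.T (I.T + m) ρ (I.staleCost m η α t t) ≤ 2 * diameter M :=
        (coinExp_mono hρ fun b e => I.staleCost_le hη hα ht t).trans_eq (coinExp_const _)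
      calc ρ * (1 - ρ * m) * coinExp I.T (I.T + m) ρ (I.staleCost m η α t t)
          ≤ ρ * 1 * (2 * diameter M) := by
            gcongr
            · exact coinExp_nonneg hρ fun b e => I.staleCost_nonneg hη hα t t
            · exact sub_le_self _ (by positivity)
        _ ≤ _ := by
            rw [mul_one]
            have := explore_nonneg t
            have := recent_nonneg t
            exact le_add_of_nonneg_left (by positivity)
    · rw [add_zero]
      exact I.coinExp_exploreCost_ge hη hα hρ hρm hm
        (mem_Icc.2 ⟨by omega, (mem_Icc.1 ht).2⟩)
  have total := sum_le_sum stepwise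
  rw [sum_add_distrib, sum_add_distrib, ← mul_sum, ← mul_sum] at total
  have recent := I.sum_coinExp_recentMovement_le (m := m) (η := η) (α := α) hρ
  have startup := sum_ite_le_startup (c := ρ * (2 * diameter M)) (by positivity) I.T m
  have factor_nonneg : 0 ≤ 4 * diameter M * ρ := by positivity
  rw [fractionalTotal, exploredTotal]
  linarith [mul_le_mul_of_nonneg_left recent factor_nonneg]

end Input

/-! ### Sums that are reset when no recent coin was tossed -/

section Damped

/-- The solution of `z (t + 1) = V (t + 1) * z t + Y (t + 1)` with `z 0 = 0`. For `V` the indicator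
of a recent coin, it accumulates `Y` over the uninterrupted past with recent coins. -/
def damped (V Y : ℕ → ℝ) : ℕ → ℝ
  | 0 => 0
  | t + 1 => V (t + 1) * damped V Y t + Y (t + 1)

variable {V V' Y Y' : ℕ → ℝ}

lemma damped_nonneg (hV : ∀ t, 0 ≤ V t) (hY : ∀ t, 0 ≤ Y t) (t : ℕ) : 0 ≤ damped V Y t := by
  induction t with
  | zero => exact le_rfl
  | succ t ih => exact add_nonneg (mul_nonneg (hV _) ih) (hY _)

lemma le_damped (hV : ∀ t, 0 ≤ V t) (hY : ∀ t, 0 ≤ Y t) (t : ℕ) :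
    Y (t + 1) ≤ damped V Y (t + 1) :=
  le_add_of_nonneg_left (mul_nonneg (hV _) (damped_nonneg hV hY t))

lemma damped_congr {t : ℕ} (hV : ∀ s ≤ t, V s = V' s) (hY : ∀ s ≤ t, Y s = Y' s) :
    damped V Y t = damped V' Y' t := by
  induction t with
  | zero => rfl
  | succ t ih =>
    rw [damped, damped, hV _ le_rfl, hY _ le_rfl, ih (fun s hs => hV s (hs.trans t.le_succ))
      fun s hs => hY s (hs.trans t.le_succ)]

variable {m : ℕ} {b : ℕ → Bool}

lemma recentCoin_nonneg (t : ℕ) : 0 ≤ recentCoin m b t := by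
  unfold recentCoin
  split_ifs <;> norm_num

lemma recentCoin_le_one (t : ℕ) : recentCoin m b t ≤ 1 := by
  unfold recentCoin
  split_ifs <;> norm_num

lemma recentCoin_update {t r : ℕ} (h : t ≤ r) (c : Bool) :
    recentCoin m (Function.update b r c) t = recentCoin m b t := by
  have recent_iff : (∃ s ∈ Ico (t - (2 : ℕ) * m) t, Function.update b r c s)
      ↔ ∃ s ∈ Ico (t - (2 : ℕ) * m) t, b s := by
    refine exists_congr fun s => and_congr_right fun hs => ?_
    rw [Function.update_of_ne (ne_of_lt ((mem_Ico.1 hs).2.trans_le h))]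
  simp only [recentCoin, recent_iff]

/-- An upper bound on the number of further times at which a recent coin is remembered. -/
def memory (m : ℕ) (b : ℕ → Bool) : ℕ → ℕ
  | 0 => 0
  | t + 1 => if b t then 2 * m else memory m b t - 1

lemma memory_le (t : ℕ) : memory m b t ≤ 2 * m := by
  induction t with
  | zero => exact Nat.zero_le _
  | succ t ih => rw [memory]; split_ifs <;> omega

lemma le_memory_add {r t : ℕ} (h : r < t) (hb : b r = true) :
    r + 2 * m + 1 ≤ memory m b t + t := by
  induction t with
  | zero => omega
  | succ t ih =>
    rw [memory]
    split_ifs with hbt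
    · omega
    · have hrt : r ≠ t := fun h => hbt (h ▸ hb)
      have := ih (by omega)
      omega

lemma memory_succ_add_one {r t : ℕ} (hr : r ∈ Ico (t + 1 - 2 * m) (t + 1)) (hbr : b r = true)
    (hb : ¬b t = true) : memory m b (t + 1) + 1 = memory m b t := by
  rw [mem_Ico] at hr
  have := le_memory_add (m := m) hr.2 hbr
  rw [memory, if_neg hb] at *
  omega

lemma recentCoin_mul_memory_le (t : ℕ) :
    recentCoin m b (t + 1) * (2 * memory m b (t + 1) + 1)
      ≤ (if b t then (4 * m + 1 : ℝ) else 0) + 2 * memory m b t := by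
  by_cases hb : b t = true
  · rw [if_pos hb, memory, if_pos hb]
    push_cast
    have := mul_le_mul_of_nonneg_right (recentCoin_le_one (m := m) (b := b) (t + 1))
      (by positivity : (0 : ℝ) ≤ 2 * (2 * m) + 1)
    have : (0 : ℝ) ≤ memory m b t := Nat.cast_nonneg _
    linarith
  · rw [if_neg hb, zero_add]
    unfold recentCoin
    split_ifs with recent
    · obtain ⟨r, hr, hbr⟩ := recent
      rw [← memory_succ_add_one hr hbr hb]
      push_cast
      linarith
    · rw [zero_mul]
      positivity

variable {ℓ : ℕ} {Y : ℕ → (ℕ → Bool) → (ℕ → Fin ℓ) → ℝ} {e : ℕ → Fin ℓ}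

/-- The sum of `Y t` over the uninterrupted past with recent coins. -/
def accumulated (m : ℕ) (Y : ℕ → (ℕ → Bool) → (ℕ → Fin ℓ) → ℝ) (t : ℕ) (b : ℕ → Bool)
    (e : ℕ → Fin ℓ) : ℝ :=
  damped (recentCoin m b) (fun s => Y s b e) t

/-- A potential that pays for the terms of `accumulated m Y` after time `t` until the next coin. -/
def potential (m : ℕ) (Y : ℕ → (ℕ → Bool) → (ℕ → Fin ℓ) → ℝ) (t : ℕ) (b : ℕ → Bool)
    (e : ℕ → Fin ℓ) : ℝ :=
  accumulated m Y t b e * (2 * memory m b t + 1)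

lemma ignoresCoin_accumulated (hY : ∀ t r, t ≤ r → IgnoresCoin r (Y t)) {t r : ℕ} (h : t ≤ r) :
    IgnoresCoin r (accumulated m Y t) := fun b e c =>
  damped_congr (fun _ hs => recentCoin_update (hs.trans h) c)
    fun s hs => hY s r (hs.trans h) b e c

section Nonneg

variable (hY0 : ∀ t b e, 0 ≤ Y t b e)
include hY0

lemma accumulated_nonneg (t : ℕ) : 0 ≤ accumulated m Y t b e :=
  damped_nonneg recentCoin_nonneg (fun s => hY0 s b e) t

lemma accumulated_le_potential (t : ℕ) : accumulated m Y t b e ≤ potential m Y t b e :=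
  le_mul_of_one_le_right (accumulated_nonneg hY0 t) (le_add_of_nonneg_left (by positivity))

lemma potential_succ_le (t : ℕ) : potential m Y (t + 1) b e
    ≤ (4 * m + 1) * Y (t + 1) b e + potential m Y t b e + (-1) * accumulated m Y t b e
      + (4 * m + 1) * (if b t then accumulated m Y t b e else 0) := by
  have old_part := mul_le_mul_of_nonneg_left (recentCoin_mul_memory_le (m := m) (b := b) t)
    (accumulated_nonneg (m := m) (b := b) (e := e) hY0 t)
  have memory_le_cast : (memory m b (t + 1) : ℝ) ≤ 2 * m := by exact_mod_cast memory_le (t + 1)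
  have new_part := mul_le_mul_of_nonneg_left
    (show 2 * (memory m b (t + 1) : ℝ) + 1 ≤ 4 * m + 1 by linarith) (hY0 (t + 1) b e)
  have split_succ : potential m Y (t + 1) b e = accumulated m Y t b e *
      (recentCoin m b (t + 1) * (2 * memory m b (t + 1) + 1))
      + Y (t + 1) b e * (2 * memory m b (t + 1) + 1) := by
    simp only [potential, accumulated, damped]
    ring
  rw [split_succ, potential]
  split_ifs at old_part ⊢ <;> linarith

variable [NeZero ℓ] {T n : ℕ} {ρ : ℝ} (hρ : ρ ∈ Set.Icc (0 : ℝ) 1)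
  (hρm : ρ * (4 * m + 1) ≤ 1 / 2) (hY : ∀ t r, t ≤ r → IgnoresCoin r (Y t))
include hρ hρm hY

lemma coinExp_potential_succ_le (t : ℕ) : coinExp T n ρ (potential m Y (t + 1))
    ≤ (4 * m + 1) * coinExp T n ρ (Y (t + 1)) + coinExp T n ρ (potential m Y t)
      - 1 / 2 * coinExp T n ρ (accumulated m Y t) := by
  have h := coinExp_mono (T := T) (n := n) hρ fun b e =>
    potential_succ_le (m := m) (b := b) (e := e) hY0 t
  rw [coinExp_add, coinExp_add, coinExp_add, coinExp_mul, coinExp_mul, coinExp_mul] at h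
  have coin := coinExp_ite_coin_le (T := T) (n := n) hρ
    (fun b e => accumulated_nonneg (m := m) (b := b) (e := e) hY0 t)
    (ignoresCoin_accumulated (m := m) hY (le_refl t))
  have coin_le := mul_le_mul_of_nonneg_left coin (show (0 : ℝ) ≤ 4 * m + 1 by positivity)
  have mean_nonneg : 0 ≤ coinExp T n ρ (accumulated m Y t) :=
    coinExp_nonneg hρ fun b e => accumulated_nonneg hY0 t
  linarith [mul_le_mul_of_nonneg_right hρm mean_nonneg]

lemma coinExp_potential_add_sum_le (N : ℕ) : coinExp T n ρ (potential m Y N)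
    + 1 / 2 * ∑ t ∈ range N, coinExp T n ρ (accumulated m Y t)
      ≤ (4 * m + 1) * ∑ t ∈ Icc 1 N, coinExp T n ρ (Y t) := by
  induction N with
  | zero =>
    have : potential m Y 0 = fun _ _ => 0 := by
      funext b e
      simp [potential, accumulated, damped]
    simp [this, coinExp_const]
  | succ N ih =>
    rw [sum_range_succ, sum_Icc_succ_top (by omega)]
    linarith [coinExp_potential_succ_le (T := T) (n := n) hY0 hρ hρm hY N]

lemma sum_coinExp_accumulated_le (hm : 1 ≤ m) :
    ∑ t ∈ Icc 1 T, coinExp T n ρ (accumulated m Y t)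
      ≤ 10 * m * ∑ t ∈ Icc 1 T, coinExp T n ρ (Y t) := by
  have mean_nonneg (t : ℕ) : 0 ≤ coinExp T n ρ (accumulated m Y t) :=
    coinExp_nonneg hρ fun b e => accumulated_nonneg hY0 t
  have last_le : coinExp T n ρ (accumulated m Y T) ≤ coinExp T n ρ (potential m Y T) :=
    coinExp_mono hρ fun b e => accumulated_le_potential hY0 T
  have shift : ∑ t ∈ Icc 1 T, coinExp T n ρ (accumulated m Y t)
      ≤ ∑ t ∈ range (T + 1), coinExp T n ρ (accumulated m Y t) := by
    rw [sum_Icc_one_eq_sum_range, sum_range_succ']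
    exact le_add_of_nonneg_right (mean_nonneg 0)
  rw [sum_range_succ] at shift
  have telescoped := coinExp_potential_add_sum_le (T := T) (n := n) hY0 hρ hρm hY T
  have Y_nonneg : 0 ≤ ∑ t ∈ Icc 1 T, coinExp T n ρ (Y t) :=
    sum_nonneg fun t _ => coinExp_nonneg hρ fun b e => hY0 t b e
  have hm' : (1 : ℝ) ≤ m := by exact_mod_cast hm
  linarith [mean_nonneg T, mul_le_mul_of_nonneg_right hm' Y_nonneg]

end Nonneg

end Damped

/-! ### The cost of the algorithm for fixed random choices -/

section Deterministic

variable {ℓ : ℕ} {m : ℕ} {b : ℕ → Bool} {e a : ℕ → Fin ℓ}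

/-- Indicator of a switch of `a` at time `t`. -/
def switchAt (a : ℕ → Fin ℓ) (t : ℕ) : ℝ := if a (t - 1) ≠ a t then 1 else 0

lemma switchAt_nonneg (t : ℕ) : 0 ≤ switchAt a t := by
  unfold switchAt
  split_ifs <;> norm_num

/-- The number of switches at the last `m` times, plus one in the start-up phase. If it vanishes and
there is no recent coin, then the state of the heuristic `a t` is known at time `t`. -/
def unsettled (m : ℕ) (a : ℕ → Fin ℓ) (t : ℕ) : ℝ :=
  (if t ≤ m then 1 else 0) + ∑ u ∈ Ioc (t - m) t, switchAt a u

lemma unsettled_nonneg (t : ℕ) : 0 ≤ unsettled m a t :=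
  add_nonneg (by split_ifs <;> norm_num) (sum_nonneg fun u _ => switchAt_nonneg u)

lemma one_le_unsettled_of_startup {t : ℕ} (h : t ≤ m) : 1 ≤ unsettled m a t := by
  rw [unsettled, if_pos h]
  exact le_add_of_nonneg_right (sum_nonneg fun u _ => switchAt_nonneg u)

lemma one_le_unsettled_of_switch {u t : ℕ} (h1 : t - m < u) (h2 : u ≤ t) (h : a (u - 1) ≠ a u) :
    1 ≤ unsettled m a t := by
  have counted : switchAt a u ≤ ∑ u ∈ Ioc (t - m) t, switchAt a u :=
    single_le_sum (fun u _ => switchAt_nonneg u) (mem_Ioc.2 ⟨h1, h2⟩)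
  rw [switchAt, if_pos h] at counted
  refine counted.trans (le_add_of_nonneg_left ?_)
  split_ifs <;> norm_num

lemma exists_switch {u t : ℕ} (h : u ≤ t) (hne : a u ≠ a t) :
    ∃ w, u < w ∧ w ≤ t ∧ a (w - 1) ≠ a w := by
  induction t, h using Nat.le_induction with
  | base => exact absurd rfl hne
  | succ t h ih =>
    by_cases hs : a t = a (t + 1)
    · obtain ⟨w, h1, h2, h3⟩ := ih (by rwa [hs])
      exact ⟨w, h1, by omega, h3⟩
    · exact ⟨t + 1, by omega, le_rfl, by simpa using hs⟩

lemma recentCoin_or_unsettled {t : ℕ} (h : ¬ Known m (query m b e a) (a t) t) :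
    recentCoin m b t = 1 ∨ 1 ≤ unsettled m a t := by
  by_cases startup : t ≤ m
  · exact Or.inr (one_le_unsettled_of_startup startup)
  obtain ⟨u, hu, hne⟩ : ∃ u ∈ Icc (t + 2 - m) t, query m b e a u ≠ a t := by
    by_contra! hcon
    exact h ⟨by omega, hcon⟩
  rw [mem_Icc] at hu
  unfold query at hne
  split_ifs at hne with idle
  · obtain ⟨w, h1, h2, h3⟩ := exists_switch hu.2 hne
    exact Or.inr (one_le_unsettled_of_switch (by omega) h2 h3)
  · obtain ⟨r, hr, hb⟩ := exists_coin_of_countdown_ne_zero idle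
    rw [mem_Ico] at hr
    exact Or.inl (if_pos ⟨r, mem_Ico.2 ⟨by omega, by omega⟩, hb⟩)

end Deterministic

lemma dist_le_diameter {M : Type*} [MetricSpace M] [BoundedSpace M] (x y : M) :
    dist x y ≤ diameter M :=
  Metric.dist_le_diam_of_mem BoundedSpace.bounded_univ (Set.mem_univ x) (Set.mem_univ y)

namespace Input

variable {M : Type*} [MetricSpace M] {ℓ : ℕ} (I : Input M ℓ)

/-- The part of the overhead of the algorithm that is caused at time `t`. -/
def overhead (m : ℕ) (b : ℕ → Bool) (a : ℕ → Fin ℓ) (t : ℕ) : ℝ :=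
  recentCoin m b t * I.hcost t (a t) + diameter M * unsettled m a t

/-- An upper bound on the distance of the last known state from the exploited heuristic. -/
def debt (m : ℕ) (b : ℕ → Bool) (a : ℕ → Fin ℓ) : ℕ → ℝ :=
  damped (recentCoin m b) (I.overhead m b a)

variable {m : ℕ} {b : ℕ → Bool} {a q : ℕ → Fin ℓ} {greedy : ℕ → M → M} {t : ℕ}

lemma mul_unsettled_le_overhead : diameter M * unsettled m a t ≤ I.overhead m b a t :=
  le_add_of_nonneg_left (mul_nonneg (recentCoin_nonneg t) (I.hcost_nonneg t _))

lemma overhead_nonneg (t : ℕ) : 0 ≤ I.overhead m b a t :=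
  (mul_nonneg diameter_nonneg (unsettled_nonneg t)).trans I.mul_unsettled_le_overhead

lemma debt_nonneg (t : ℕ) : 0 ≤ I.debt m b a t :=
  damped_nonneg recentCoin_nonneg I.overhead_nonneg t

lemma overhead_le_debt : I.overhead m b a (t + 1) ≤ I.debt m b a (t + 1) :=
  le_damped recentCoin_nonneg I.overhead_nonneg t

lemma diameter_le_debt_of_unsettled (h : 1 ≤ unsettled m a (t + 1)) :
    diameter M ≤ I.debt m b a (t + 1) :=
  (le_mul_of_one_le_right diameter_nonneg h).trans
    (I.mul_unsettled_le_overhead.trans I.overhead_le_debt)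

lemma debt_add_hcost_le (h : recentCoin m b (t + 1) = 1) :
    I.debt m b a t + I.hcost (t + 1) (a (t + 1)) ≤ I.debt m b a (t + 1) := by
  have := mul_nonneg (diameter_nonneg (M := M)) (unsettled_nonneg (m := m) (a := a) (t + 1))
  simp only [debt, damped, overhead, h, one_mul]
  linarith

lemma sum_debt_pred_le :
    ∑ t ∈ Icc 1 I.T, I.debt m b a (t - 1) ≤ ∑ t ∈ Icc 1 I.T, I.debt m b a t := by
  rw [sum_Icc_one_eq_sum_range, sum_Icc_one_eq_sum_range]
  have h := sum_range_succ (I.debt m b a) I.T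
  rw [sum_range_succ', show I.debt m b a 0 = 0 from rfl] at h
  simp only [Nat.add_sub_cancel]
  linarith [I.debt_nonneg (m := m) (b := b) (a := a) I.T]

lemma cost_ne_top (ht : t ∈ Icc 1 I.T) (i : Fin ℓ) : I.cost t (I.state t i) ≠ ⊤ :=
  (ENNReal.add_ne_top.1 (ne_top_of_le_ne_top ENNReal.ofReal_ne_top (I.heuristicCost_le ht i))).1

lemma hcost_succ_eq (ht : t + 1 ∈ Icc 1 I.T) (i : Fin ℓ) :
    I.hcost (t + 1) i = (I.cost (t + 1) (I.state (t + 1) i)).toReal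
      + dist (I.state t i) (I.state (t + 1) i) := by
  rw [hcost, heuristicCost, ENNReal.toReal_add (I.cost_ne_top ht i) (edist_ne_top _ _),
    Nat.add_sub_cancel, edist_dist, ENNReal.toReal_ofReal dist_nonneg]

lemma dist_state_le_hcost (ht : t + 1 ∈ Icc 1 I.T) (i : Fin ℓ) :
    dist (I.state t i) (I.state (t + 1) i) ≤ I.hcost (t + 1) i := by
  rw [I.hcost_succ_eq ht]
  exact le_add_of_nonneg_left ENNReal.toReal_nonneg

lemma cost_toReal_le_hcost (ht : t + 1 ∈ Icc 1 I.T) (i : Fin ℓ) :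
    (I.cost (t + 1) (I.state (t + 1) i)).toReal ≤ I.hcost (t + 1) i := by
  rw [I.hcost_succ_eq ht]
  exact le_add_of_nonneg_right dist_nonneg

lemma hcost_le_two_mul_debt (ht : t + 1 ∈ Icc 1 I.T)
    (h : recentCoin m b (t + 1) = 1 ∨ 1 ≤ unsettled m a (t + 1)) :
    I.hcost (t + 1) (a (t + 1)) ≤ 2 * I.debt m b a (t + 1) := by
  rcases h with coin | hu
  · linarith [I.debt_add_hcost_le (a := a) coin, I.debt_nonneg (m := m) (b := b) (a := a) t,
      I.debt_nonneg (m := m) (b := b) (a := a) (t + 1)]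
  · linarith [I.hcost_le ht (a (t + 1)), I.diameter_le_debt_of_unsettled (b := b) hu]

variable [BoundedSpace M]

lemma cost_add_dist_state_le (ht : t + 1 ∈ Icc 1 I.T) :
    (I.cost (t + 1) (I.state (t + 1) (a (t + 1)))).toReal
        + dist (I.state t (a t)) (I.state (t + 1) (a (t + 1)))
      ≤ I.hcost (t + 1) (a (t + 1)) + diameter M * switchAt a (t + 1) := by
  rw [I.hcost_succ_eq ht, switchAt, Nat.add_sub_cancel]
  split_ifs with switch
  · have := dist_le_diameter (I.state t (a t)) (I.state t (a (t + 1)))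
    have := dist_triangle (I.state t (a t)) (I.state t (a (t + 1))) (I.state (t + 1) (a (t + 1)))
    linarith
  · rw [not_not.1 switch]
    linarith

variable (hq : ∀ t, ¬ Known m q (a t) t → recentCoin m b t = 1 ∨ 1 ≤ unsettled m a t)
include hq

lemma dist_lastKnown_le (ht : t ≤ I.T) :
    dist (I.lastKnown m q a t) (I.state t (a t)) ≤ I.debt m b a t := by
  induction t with
  | zero => simp [lastKnown, I.state_zero, debt, damped]
  | succ t ih =>
    rw [lastKnown]
    split_ifs with known
    · rw [dist_self]
      exact I.debt_nonneg _
    by_cases hu : 1 ≤ unsettled m a (t + 1)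
    · exact (dist_le_diameter _ _).trans (I.diameter_le_debt_of_unsettled hu)
    have coin := (hq _ known).resolve_right hu
    have no_switch : a t = a (t + 1) := by
      by_contra hne
      refine hu ?_
      by_cases hm : m = 0
      · exact absurd coin (by simp [recentCoin, hm])
      · exact one_le_unsettled_of_switch (by omega) le_rfl hne
    calc dist (I.lastKnown m q a t) (I.state (t + 1) (a (t + 1)))
        ≤ dist (I.lastKnown m q a t) (I.state t (a t))
          + dist (I.state t (a t)) (I.state (t + 1) (a (t + 1))) := dist_triangle _ _ _
      _ ≤ I.debt m b a t + I.hcost (t + 1) (a (t + 1)) := by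
          refine add_le_add (ih (by omega)) ?_
          rw [no_switch]
          exact I.dist_state_le_hcost (mem_Icc.2 ⟨by omega, ht⟩) _
      _ ≤ I.debt m b a (t + 1) := I.debt_add_hcost_le coin

lemma edist_lastKnown_succ_le (ht : t + 1 ∈ Icc 1 I.T) :
    edist (I.lastKnown m q a t) (I.lastKnown m q a (t + 1))
      ≤ ENNReal.ofReal (I.debt m b a t
          + dist (I.state t (a t)) (I.state (t + 1) (a (t + 1)))) := by
  rw [lastKnown]
  split_ifs with known
  · rw [edist_dist]
    refine ENNReal.ofReal_le_ofReal ((dist_triangle _ (I.state t (a t)) _).trans ?_)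
    have := (mem_Icc.1 ht).2
    exact add_le_add_left (I.dist_lastKnown_le hq (by omega)) _
  · rw [edist_self]
    exact zero_le

variable (hg : I.IsGreedy greedy)
include hg

lemma cost_position_add_edist_le (ht : t + 1 ∈ Icc 1 I.T) :
    I.cost (t + 1) (I.position m greedy q a (t + 1))
        + edist (I.lastKnown m q a (t + 1)) (I.position m greedy q a (t + 1))
      ≤ ENNReal.ofReal (I.debt m b a (t + 1)
          + (I.cost (t + 1) (I.state (t + 1) (a (t + 1)))).toReal) := by
  calc I.cost (t + 1) (I.position m greedy q a (t + 1))
        + edist (I.lastKnown m q a (t + 1)) (I.position m greedy q a (t + 1))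
      ≤ edist (I.lastKnown m q a (t + 1)) (I.state (t + 1) (a (t + 1)))
        + I.cost (t + 1) (I.state (t + 1) (a (t + 1))) := by
        rw [add_comm]
        by_cases known : Known m q (a (t + 1)) (t + 1)
        · rw [position, lastKnown, if_pos known, if_pos known]
        · rw [position, if_neg known]
          exact hg (t + 1) ht _ _
    _ ≤ _ := by
        rw [ENNReal.ofReal_add (I.debt_nonneg _) ENNReal.toReal_nonneg,
          ENNReal.ofReal_toReal (I.cost_ne_top ht _), edist_dist]
        gcongr
        exact I.dist_lastKnown_le hq (mem_Icc.1 ht).2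

lemma edist_lastKnown_position_le (ht : t ≤ I.T) :
    edist (I.lastKnown m q a t) (I.position m greedy q a t)
      ≤ ENNReal.ofReal (3 * I.debt m b a t) := by
  rcases t with _ | t
  · simp [lastKnown, position]
  by_cases known : Known m q (a (t + 1)) (t + 1)
  · rw [position, lastKnown, if_pos known, if_pos known, edist_self]
    exact zero_le
  · have ht' : t + 1 ∈ Icc 1 I.T := mem_Icc.2 ⟨by omega, ht⟩
    refine (le_add_self.trans (I.cost_position_add_edist_le hq hg ht')).trans
      (ENNReal.ofReal_le_ofReal ?_)
    linarith [I.cost_toReal_le_hcost ht' (a (t + 1)), I.hcost_le_two_mul_debt ht' (hq _ known)]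

lemma step_cost_le (ht : t + 1 ∈ Icc 1 I.T) :
    I.cost (t + 1) (I.position m greedy q a (t + 1))
        + edist (I.position m greedy q a t) (I.position m greedy q a (t + 1))
      ≤ ENNReal.ofReal (I.hcost (t + 1) (a (t + 1)) + diameter M * switchAt a (t + 1)
          + I.debt m b a (t + 1) + 4 * I.debt m b a t) := by
  have debt_nonneg (s : ℕ) : 0 ≤ I.debt m b a s := I.debt_nonneg s
  set p := I.position m greedy q a
  set B := I.lastKnown m q a
  calc I.cost (t + 1) (p (t + 1)) + edist (p t) (p (t + 1))
      ≤ I.cost (t + 1) (p (t + 1))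
        + (edist (p t) (B t) + edist (B t) (B (t + 1)) + edist (B (t + 1)) (p (t + 1))) := by
        gcongr
        exact edist_triangle4 _ _ _ _
    _ = (I.cost (t + 1) (p (t + 1)) + edist (B (t + 1)) (p (t + 1)))
        + edist (B t) (B (t + 1)) + edist (B t) (p t) := by
        rw [edist_comm (p t)]
        ring
    _ ≤ _ := add_le_add (add_le_add (I.cost_position_add_edist_le hq hg ht)
        (I.edist_lastKnown_succ_le hq ht))
        (I.edist_lastKnown_position_le hq hg ((Nat.le_succ t).trans (mem_Icc.1 ht).2))
    _ ≤ _ := by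
        rw [← ENNReal.ofReal_add (add_nonneg (debt_nonneg _) ENNReal.toReal_nonneg)
            (add_nonneg (debt_nonneg _) dist_nonneg),
          ← ENNReal.ofReal_add (add_nonneg (add_nonneg (debt_nonneg _) ENNReal.toReal_nonneg)
            (add_nonneg (debt_nonneg _) dist_nonneg)) (mul_nonneg (by norm_num) (debt_nonneg _))]
        exact ENNReal.ofReal_le_ofReal (by linarith [I.cost_add_dist_state_le (a := a) ht])

omit hq

theorem algCost_le (e : ℕ → Fin ℓ) :
    I.algCost m greedy b e a ≤ ENNReal.ofReal (∑ t ∈ Icc 1 I.T,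
      (I.hcost t (a t) + diameter M * switchAt a t + 5 * I.debt m b a t)) := by
  have summand_nonneg (t : ℕ) : 0 ≤ I.hcost t (a t) + diameter M * switchAt a t
      + I.debt m b a t + 4 * I.debt m b a (t - 1) := by
    have := I.hcost_nonneg t (a t)
    have := mul_nonneg (diameter_nonneg (M := M)) (switchAt_nonneg (a := a) t)
    linarith [I.debt_nonneg (m := m) (b := b) (a := a) t,
      I.debt_nonneg (m := m) (b := b) (a := a) (t - 1)]
  calc I.algCost m greedy b e a
      ≤ ∑ t ∈ Icc 1 I.T, ENNReal.ofReal (I.hcost t (a t) + diameter M * switchAt a t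
          + I.debt m b a t + 4 * I.debt m b a (t - 1)) := by
        refine sum_le_sum fun t ht => ?_
        obtain ⟨s, rfl⟩ : ∃ s, t = s + 1 := ⟨t - 1, by rw [mem_Icc] at ht; omega⟩
        exact I.step_cost_le (fun _ => recentCoin_or_unsettled) hg ht
    _ = ENNReal.ofReal (∑ t ∈ Icc 1 I.T, (I.hcost t (a t) + diameter M * switchAt a t
          + I.debt m b a t + 4 * I.debt m b a (t - 1))) :=
        (ENNReal.ofReal_sum_of_nonneg fun t _ => summand_nonneg t).symm
    _ ≤ _ := by
        refine ENNReal.ofReal_le_ofReal ?_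
        have := I.sum_debt_pred_le (m := m) (b := b) (a := a)
        simp only [sum_add_distrib, ← mul_sum]
        linarith

end Input

/-! ### Rounding and the expected cost of the algorithm -/

section Transition

variable {ℓ : ℕ} {τ : (Fin ℓ → ℝ) → (Fin ℓ → ℝ) → Fin ℓ → Fin ℓ → ℝ} {p p' : Fin ℓ → ℝ}
  (hτ : IsTransport p p' (τ p p')) (hp : ∀ i, 0 < p i)
include hτ hp

lemma sum_mul_transition (j : Fin ℓ) : ∑ i, p i * transition τ p p' i j = p' j := by
  unfold transition
  split_ifs with h
  · rw [← hτ.col j]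
    exact sum_congr rfl fun i _ => mul_div_cancel₀ _ (hp i).ne'
  · rw [not_not] at h
    rw [h]
    simp

lemma sum_transition (i : Fin ℓ) : ∑ j, transition τ p p' i j = 1 := by
  unfold transition
  split_ifs with h
  · rw [← sum_div, hτ.row i, div_self (hp i).ne']
  · simp

lemma transition_nonneg (i j : Fin ℓ) : 0 ≤ transition τ p p' i j := by
  unfold transition
  split_ifs
  · exact div_nonneg (hτ.nonneg i j) (hp i).le
  · exact zero_le_one
  · exact le_rfl

lemma sum_switch_transition :
    ∑ i, ∑ j, p i * transition τ p p' i j * (if i ≠ j then 1 else 0) = moved p p' := by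
  unfold transition
  split_ifs with h
  · rw [moved, ← hτ.moved]
    refine sum_congr rfl fun i _ => ?_
    rw [← add_sum_erase _ _ (mem_univ i), if_neg (by simp), mul_zero, zero_add]
    refine sum_congr rfl fun j hj => ?_
    rw [if_pos (ne_of_mem_erase hj).symm, mul_one, mul_div_cancel₀ _ (hp i).ne']
  · rw [not_not] at h
    rw [h, moved_self]
    refine sum_eq_zero fun i _ => sum_eq_zero fun j _ => ?_
    by_cases hij : i = j
    · simp [hij]
    · simp [Ne.symm hij]

end Transition

namespace Input

variable {M : Type*} [MetricSpace M] {ℓ : ℕ} (I : Input M ℓ) (m : ℕ) (η α : ℝ)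

/-- The expectation, given the coins and the explored heuristics, of the part of the overhead that
is caused at time `t`. -/
def meanOverhead (t : ℕ) (b : ℕ → Bool) (e : ℕ → Fin ℓ) : ℝ :=
  recentCoin m b t * I.staleCost m η α t t b e + diameter M *
    ((if t ≤ m then 1 else 0) + ∑ u ∈ Ioc (t - m) t, I.movement m η α u b e)

variable (τ : (Fin ℓ → ℝ) → (Fin ℓ → ℝ) → Fin ℓ → Fin ℓ → ℝ)

/-- The transition matrices of the exploited heuristic, given the coins and the explored
heuristics. -/
def roundingChain (b : ℕ → Bool) (e : ℕ → Fin ℓ) (t : ℕ) : Fin ℓ → Fin ℓ → ℝ :=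
  transition τ (I.fractional m η α b e (t - 1)) (I.fractional m η α b e t)

variable [NeZero ℓ]

/-- The expectation of a function of the exploited heuristics, given the coins and the explored
heuristics. -/
def roundingMean (b : ℕ → Bool) (e : ℕ → Fin ℓ) (F : (ℕ → Fin ℓ) → ℝ) : ℝ :=
  pathMean (I.fractional m η α b e 0) (I.roundingChain m η α τ b e) I.T F

variable {m η α τ} {b : ℕ → Bool} {e : ℕ → Fin ℓ} {t : ℕ}

lemma prob_eq (ρ : ℝ) (β : Fin I.T → Bool) (e : Fin (I.T + m) → Fin ℓ)
    (a : Fin (I.T + 1) → Fin ℓ) : I.prob m ρ η α τ β e a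
      = (∏ t, coinProb ρ (β t)) * ((∏ _t : Fin (I.T + m), (1 / ℓ : ℝ)) *
        pathWeight (I.fractional m η α (fromOne β) (fromOne e) 0)
          (I.roundingChain m η α τ (fromOne β) (fromOne e)) I.T (fromZero a)) := by
  have start_uniform (i : Fin ℓ) :
      I.fractional m η α (fromOne β) (fromOne e) 0 i = 1 / ℓ := by
    simp [fractional, weights]
  simp only [prob, coinProb, pathWeight, roundingChain, start_uniform]
  ring

section MeanOverhead

variable (hη : 0 ≤ η) (hα : 0 ≤ α)
include hη hα

lemma meanOverhead_nonneg (t : ℕ) (b : ℕ → Bool) (e : ℕ → Fin ℓ) :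
    0 ≤ I.meanOverhead m η α t b e :=
  add_nonneg (mul_nonneg (recentCoin_nonneg t) (I.staleCost_nonneg hη hα t t))
    (mul_nonneg diameter_nonneg (add_nonneg (by split_ifs <;> norm_num)
      (sum_nonneg fun u _ => I.movement_nonneg u)))

omit [NeZero ℓ] hη hα in
lemma ignoresCoin_meanOverhead {r : ℕ} (h : t ≤ r) : IgnoresCoin r (I.meanOverhead m η α t) :=
  fun b e c => by
    rw [meanOverhead, meanOverhead, recentCoin_update h, I.ignoresCoin_staleCost h t b e c]
    congr 3
    exact sum_congr rfl fun u hu => I.ignoresCoin_movement ((mem_Ioc.1 hu).2.trans h) b e c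

lemma sum_coinExp_meanOverhead_le {ρ : ℝ} (hρ : ρ ∈ Set.Icc (0 : ℝ) 1)
    (hρm : ρ * (4 * m + 1) ≤ 1 / 2) :
    ∑ t ∈ Icc 1 I.T, coinExp I.T (I.T + m) ρ (I.meanOverhead m η α t)
      ≤ 2 * m * ρ * I.fractionalTotal m η α ρ
        + 7 * diameter M * m * I.movementTotal m η α ρ + diameter M * m := by
  have hD := diameter_nonneg (M := M)
  have coinExp_eq (t : ℕ) : coinExp I.T (I.T + m) ρ (I.meanOverhead m η α t)
      = coinExp I.T (I.T + m) ρ (fun b e => recentCoin m b t * I.staleCost m η α t t b e)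
        + diameter M * ((if t ≤ m then 1 else 0)
          + ∑ u ∈ Ioc (t - m) t, coinExp I.T (I.T + m) ρ (I.movement m η α u)) := by
    unfold meanOverhead
    rw [coinExp_add, coinExp_mul, coinExp_add, coinExp_const, coinExp_sum]
  have stale := I.sum_coinExp_recentCoin_mul_le (m := m) hρ hη hα
  have startup := sum_ite_le_startup (zero_le_one (α := ℝ)) I.T m
  have window : _ ≤ m * I.movementTotal m η α ρ := sum_window_le (fun u =>
    coinExp_nonneg (T := I.T) (n := I.T + m) hρ fun b e =>
      I.movement_nonneg (m := m) (η := η) (α := α) (b := b) (e := e) u) I.T m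
  have overlap : 4 * diameter M * m * (1 + 2 * m * ρ) * I.movementTotal m η α ρ
      ≤ 6 * diameter M * m * I.movementTotal m η α ρ := by
    have : 4 * (1 + 2 * m * ρ) ≤ 6 := by linarith [hρ.1]
    have := mul_le_mul_of_nonneg_left this
      (mul_nonneg (mul_nonneg hD m.cast_nonneg)
        (I.movementTotal_nonneg (m := m) (η := η) (α := α) hρ))
    linarith
  simp only [coinExp_eq, sum_add_distrib, ← mul_sum]
  linarith [mul_le_mul_of_nonneg_left (add_le_add startup window) hD]

lemma sum_coinExp_accumulated_meanOverhead_le {ρ : ℝ} (hρ : ρ ∈ Set.Icc (0 : ℝ) 1)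
    (hρm : ρ * (4 * m + 1) ≤ 1 / 2) (hm : 1 ≤ m) :
    ∑ t ∈ Icc 1 I.T, coinExp I.T (I.T + m) ρ (accumulated m (I.meanOverhead m η α) t)
      ≤ 10 * m * (2 * m * ρ * I.fractionalTotal m η α ρ
        + 7 * diameter M * m * I.movementTotal m η α ρ + diameter M * m) :=
  (sum_coinExp_accumulated_le (I.meanOverhead_nonneg hη hα) hρ hρm
    (fun _ _ => I.ignoresCoin_meanOverhead) hm).trans
    (mul_le_mul_of_nonneg_left (I.sum_coinExp_meanOverhead_le hη hα hρ hρm) (by positivity))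

end MeanOverhead

section Rounding

variable (hη : 0 ≤ η) (hα : 0 ≤ α) (hτ : IsRounding τ)
include hη hα hτ

lemma isTransport_fractional (s t : ℕ) :
    IsTransport (I.fractional m η α b e s) (I.fractional m η α b e t)
      (τ (I.fractional m η α b e s) (I.fractional m η α b e t)) :=
  hτ _ ⟨fun i => (I.fractional_pos hη hα s i).le, I.sum_fractional hη hα s⟩
    _ ⟨fun i => (I.fractional_pos hη hα t i).le, I.sum_fractional hη hα t⟩

lemma isMarkovFlow_roundingChain :
    IsMarkovFlow (I.fractional m η α b e) (I.roundingChain m η α τ b e) where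
  flow t := sum_mul_transition (I.isTransport_fractional hη hα hτ t (t + 1))
    (I.fractional_pos hη hα t)
  row t := sum_transition (I.isTransport_fractional hη hα hτ t (t + 1)) (I.fractional_pos hη hα t)

lemma roundingMean_hcost (ht : t ∈ Icc 1 I.T) :
    I.roundingMean m η α τ b e (fun a => I.hcost t (a t)) = I.staleCost m η α t t b e := by
  rw [mem_Icc] at ht
  obtain ⟨s, rfl⟩ : ∃ s, t = s + 1 := ⟨t - 1, by omega⟩
  exact (I.isMarkovFlow_roundingChain hη hα hτ).pathMean_eval ht.2 (I.hcost (s + 1))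

lemma roundingMean_switchAt (ht : t ∈ Icc 1 I.T) :
    I.roundingMean m η α τ b e (fun a => switchAt a t) = I.movement m η α t b e := by
  rw [mem_Icc] at ht
  obtain ⟨s, rfl⟩ : ∃ s, t = s + 1 := ⟨t - 1, by omega⟩
  exact ((I.isMarkovFlow_roundingChain hη hα hτ).pathMean_step ht.2 fun i j =>
    if i ≠ j then 1 else 0).trans (sum_switch_transition
      (I.isTransport_fractional hη hα hτ s (s + 1)) (I.fractional_pos hη hα s))

lemma roundingMean_overhead (ht : t ∈ Icc 1 I.T) :
    I.roundingMean m η α τ b e (fun a => I.overhead m b a t) = I.meanOverhead m η α t b e := by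
  have startup := (I.isMarkovFlow_roundingChain (m := m) (b := b) (e := e) hη hα hτ).pathMean_const
    (I.sum_fractional hη hα I.T) (if t ≤ m then (1 : ℝ) else 0)
  have window : ∀ u ∈ Ioc (t - m) t, I.roundingMean m η α τ b e (fun a => switchAt a u)
      = I.movement m η α u b e := fun u hu => I.roundingMean_switchAt hη hα hτ <| by
    rw [mem_Icc] at ht ⊢
    rw [mem_Ioc] at hu
    omega
  have cost := I.roundingMean_hcost (m := m) (b := b) (e := e) hη hα hτ ht
  simp only [roundingMean] at window cost ⊢
  simp only [overhead, unsettled]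
  rw [pathMean_add, pathMean_mul, pathMean_mul, pathMean_add, pathMean_sum, startup, cost,
    sum_congr rfl window, meanOverhead]

lemma roundingMean_debt (ht : t ≤ I.T) : I.roundingMean m η α τ b e (fun a => I.debt m b a t)
    = accumulated m (I.meanOverhead m η α) t b e := by
  induction t with
  | zero => simp [debt, accumulated, damped, roundingMean, pathMean]
  | succ t ih =>
    have overhead := I.roundingMean_overhead (m := m) (b := b) (e := e) hη hα hτ
      (mem_Icc.2 ⟨t.succ_pos, ht⟩)
    simp only [roundingMean, debt, damped, accumulated] at ih overhead ⊢
    rw [pathMean_add, pathMean_mul, ih (by omega), overhead]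

lemma pathWeight_roundingChain_nonneg (a : ℕ → Fin ℓ) :
    0 ≤ pathWeight (I.fractional m η α b e 0) (I.roundingChain m η α τ b e) I.T a :=
  mul_nonneg (I.fractional_pos hη hα 0 _).le <| prod_nonneg fun _ _ =>
    transition_nonneg (I.isTransport_fractional hη hα hτ _ _) (I.fractional_pos hη hα _) _ _

variable {ρ : ℝ} (hρ : ρ ∈ Set.Icc (0 : ℝ) 1) {greedy : ℕ → M → M}
include hρ

lemma prob_nonneg (β : Fin I.T → Bool) (e : Fin (I.T + m) → Fin ℓ) (a : Fin (I.T + 1) → Fin ℓ) :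
    0 ≤ I.prob m ρ η α τ β e a := by
  rw [prob_eq]
  exact mul_nonneg (prod_nonneg fun t _ => coinProb_nonneg hρ _)
    (mul_nonneg (prod_nonneg fun _ _ => by positivity)
      (I.pathWeight_roundingChain_nonneg hη hα hτ _))

lemma expectedCost_le_of_algCost_le {bound : (ℕ → Bool) → (ℕ → Fin ℓ) → ℝ}
    (nonneg : ∀ b a, 0 ≤ bound b a)
    (le_bound : ∀ b e a, I.algCost m greedy b e a ≤ ENNReal.ofReal (bound b a)) :
    I.expectedCost m ρ η α τ greedy ≤ ENNReal.ofReal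
      (coinExp I.T (I.T + m) ρ fun b e => I.roundingMean m η α τ b e (bound b)) := by
  have mean_eq : (coinExp I.T (I.T + m) ρ fun b e => I.roundingMean m η α τ b e (bound b))
      = ∑ β : Fin I.T → Bool, ∑ e : Fin (I.T + m) → Fin ℓ, ∑ a : Fin (I.T + 1) → Fin ℓ,
        I.prob m ρ η α τ β e a * bound (fromOne β) (fromZero a) := by
    simp only [coinExp, exploredMean, productMean, roundingMean, pathMean, prob_eq, mul_sum,
      mul_assoc]
  have term_nonneg (β e a) :
      0 ≤ I.prob m ρ η α τ β e a * bound (fromOne β) (fromZero a) :=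
    mul_nonneg (I.prob_nonneg hη hα hτ hρ β e a) (nonneg _ _)
  rw [mean_eq, ENNReal.ofReal_sum_of_nonneg fun β _ => sum_nonneg fun e _ =>
    sum_nonneg fun a _ => term_nonneg β e a]
  refine sum_le_sum fun β _ => ?_
  rw [ENNReal.ofReal_sum_of_nonneg fun e _ => sum_nonneg fun a _ => term_nonneg β e a]
  refine sum_le_sum fun e _ => ?_
  rw [ENNReal.ofReal_sum_of_nonneg fun a _ => term_nonneg β e a]
  refine sum_le_sum fun a _ => ?_
  rw [ENNReal.ofReal_mul (I.prob_nonneg hη hα hτ hρ β e a)]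
  exact mul_le_mul_right (le_bound _ _ _) _

omit hρ in
lemma roundingMean_algCost_bound (b : ℕ → Bool) (e : ℕ → Fin ℓ) :
    I.roundingMean m η α τ b e (fun a => ∑ t ∈ Icc 1 I.T,
        (I.hcost t (a t) + diameter M * switchAt a t + 5 * I.debt m b a t))
      = ∑ t ∈ Icc 1 I.T, (I.staleCost m η α t t b e + diameter M * I.movement m η α t b e
        + 5 * accumulated m (I.meanOverhead m η α) t b e) := by
  refine (pathMean_sum _ _).trans (sum_congr rfl fun t ht => ?_)
  rw [pathMean_add, pathMean_add, pathMean_mul, pathMean_mul,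
    ← I.roundingMean_hcost hη hα hτ ht, ← I.roundingMean_switchAt hη hα hτ ht,
    ← I.roundingMean_debt hη hα hτ (mem_Icc.1 ht).2]
  rfl

lemma expectedCost_le [BoundedSpace M] (hg : I.IsGreedy greedy) :
    I.expectedCost m ρ η α τ greedy ≤ ENNReal.ofReal
      (I.fractionalTotal m η α ρ + diameter M * I.movementTotal m η α ρ
        + 5 * ∑ t ∈ Icc 1 I.T,
          coinExp I.T (I.T + m) ρ (accumulated m (I.meanOverhead m η α) t)) := by
  refine (I.expectedCost_le_of_algCost_le hη hα hτ hρ (bound := fun b a => ∑ t ∈ Icc 1 I.T,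
    (I.hcost t (a t) + diameter M * switchAt a t + 5 * I.debt m b a t))
    (fun b a => sum_nonneg fun t _ => add_nonneg (add_nonneg (I.hcost_nonneg t _)
      (mul_nonneg diameter_nonneg (switchAt_nonneg t)))
      (mul_nonneg (by norm_num) (I.debt_nonneg t)))
    fun b e a => I.algCost_le hg e).trans_eq ?_
  simp only [I.roundingMean_algCost_bound hη hα hτ]
  simp only [coinExp_sum, coinExp_add, coinExp_mul, sum_add_distrib, ← mul_sum]
  rfl

end Rounding

end Input

/-! ### The comparator -/

section Comparator

variable {M : Type*} [MetricSpace M]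

lemma boundedSpace_of_diameter_pos (h : 0 < diameter M) : BoundedSpace M :=
  ⟨by_contra fun hb => h.ne' (Metric.diam_eq_zero_of_unbounded hb)⟩

variable [BoundedSpace M] {ℓ : ℕ} (I : Input M ℓ)

namespace Input

lemma heuristicCost_le_add_switch {t : ℕ} (a : ℕ → Fin ℓ) : I.heuristicCost t (a t)
    ≤ I.cost t (I.state t (a t)) + edist (I.state (t - 1) (a (t - 1))) (I.state t (a t))
      + if 2 ≤ t ∧ a (t - 1) ≠ a t then ENNReal.ofReal (diameter M) else 0 := by
  rw [heuristicCost, add_assoc]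
  gcongr
  split_ifs with switch
  · refine (edist_triangle _ (I.state (t - 1) (a (t - 1))) _).trans ?_
    rw [add_comm]
    gcongr
    rw [edist_dist]
    exact ENNReal.ofReal_le_ofReal (dist_le_diameter _ _)
  · rw [add_zero]
    rcases Nat.lt_or_ge t 2 with first | later
    · rw [show t - 1 = 0 by omega, I.state_zero, I.state_zero]
    · rw [not_and, not_not] at switch
      rw [switch later]

lemma sum_hcost_le (a : ℕ → Fin ℓ) : ENNReal.ofReal (∑ t ∈ Icc 1 I.T, I.hcost t (a t))
    ≤ I.combinationCost a + ENNReal.ofReal (switches I.T a * diameter M) := by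
  have switch_cost : ENNReal.ofReal (switches I.T a * diameter M) = ∑ t ∈ Icc 1 I.T,
      if 2 ≤ t ∧ a (t - 1) ≠ a t then ENNReal.ofReal (diameter M) else 0 := by
    rw [← sum_filter, sum_const, nsmul_eq_mul, ENNReal.ofReal_mul (Nat.cast_nonneg _),
      ENNReal.ofReal_natCast, switches]
    congr 3
    ext t
    simp only [mem_filter, mem_Icc]
    grind
  rw [ENNReal.ofReal_sum_of_nonneg fun t _ => I.hcost_nonneg t _, switch_cost, combinationCost,
    ← sum_add_distrib]
  refine sum_le_sum fun t ht => ?_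
  rw [I.ofReal_hcost ht]
  exact I.heuristicCost_le_add_switch a

lemma exists_comparator {k : ℕ} (hO : 0 < I.opt k) :
    ∃ a : ℕ → Fin ℓ, switches I.T a ≤ k ∧
      ∑ t ∈ Icc 1 I.T, I.hcost t (a t) ≤ I.opt k + 1 + k * diameter M := by
  have hD := diameter_nonneg (M := M)
  have opt_ne_top : (⨅ (a : ℕ → Fin ℓ) (_ : switches I.T a ≤ k), I.combinationCost a) ≠ ⊤ := by
    intro h
    simp [opt, h] at hO
  obtain ⟨a, ha, near_opt⟩ :
      ∃ a, ∃ _ : switches I.T a ≤ k, I.combinationCost a < ENNReal.ofReal (I.opt k) + 1 := by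
    rw [opt, ENNReal.ofReal_toReal opt_ne_top]
    simpa only [iInf_lt_iff] using ENNReal.lt_add_right opt_ne_top one_ne_zero
  refine ⟨a, ha, (ENNReal.ofReal_le_ofReal_iff (by positivity)).1 ?_⟩
  rw [ENNReal.ofReal_add (by positivity) (by positivity), ENNReal.ofReal_add hO.le zero_le_one,
    ENNReal.ofReal_one]
  exact (I.sum_hcost_le a).trans (add_le_add near_opt.le (ENNReal.ofReal_le_ofReal (by gcongr)))

end Input

end Comparator

/-! ### The parameters -/

lemma rpow_third_pow {x : ℝ} (hx : 0 ≤ x) : (x ^ (1 / 3 : ℝ)) ^ 3 = x := by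
  rw [← Real.rpow_natCast, ← Real.rpow_mul hx]
  norm_num

lemma log_inv_one_sub_le {γ : ℝ} (h0 : 0 ≤ γ) (h1 : γ ≤ 1 / 2) :
    Real.log (1 / (1 - γ)) ≤ γ * (1 + 2 * γ) := by
  have sub_pos : 0 < 1 - γ := by linarith
  refine (Real.log_le_sub_one_of_pos (by positivity)).trans ?_
  rw [div_sub_one sub_pos.ne', div_le_iff₀ sub_pos]
  nlinarith [mul_nonneg (mul_nonneg h0 h0) (sub_nonneg.2 h1)]

/-- The relations between the diameter `D`, the number `ℓ` of heuristics, the delay `m`, the number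
`k` of switches, the benchmark `O`, the exploration rate `ρ`, the parameter `γ` and the logarithmic
factor `Λ` on which the competitive analysis rests. The sharing parameter is `γ ^ 2` and the
learning rate is `log (1 / (1 - γ))`. -/
structure IsTuned (D ℓ m k O ρ γ Λ : ℝ) : Prop where
  one_le_diameter : 1 ≤ D
  one_le_card : 1 ≤ ℓ
  one_le_delay : 1 ≤ m
  one_le_switches : 1 ≤ k
  opt_pos : 0 < O
  rate_pos : 0 < ρ
  gamma_eq : γ = ρ * m ^ 2
  rate_pow : ρ ^ 3 * m ^ 4 * O = D * ℓ * k
  diameter_mul_le : D * m ^ 2 ≤ γ * O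
  one_le_logFactor : 1 ≤ Λ
  gamma_mul_logFactor_le : γ * Λ ≤ 1 / 210
  log_le : Real.log (2 * ℓ / γ ^ 2) ≤ 2 * Λ

namespace IsTuned

variable {D ℓ m k O ρ γ Λ : ℝ} (h : IsTuned D ℓ m k O ρ γ Λ)
include h

lemma gamma_pos : 0 < γ := by
  have := h.rate_pos
  have := h.one_le_delay
  rw [h.gamma_eq]
  positivity

lemma gamma_le_mul_logFactor : γ ≤ γ * Λ := le_mul_of_one_le_right h.gamma_pos.le h.one_le_logFactor

lemma gamma_le : γ ≤ 1 / 210 := h.gamma_le_mul_logFactor.trans h.gamma_mul_logFactor_le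

lemma gamma_sq_le : γ ^ 2 ≤ 1 / 210 * γ := by
  rw [sq]
  exact mul_le_mul_of_nonneg_right h.gamma_le h.gamma_pos.le

lemma gamma_sq_mul_opt_le : γ ^ 2 * O ≤ 1 / 210 * (γ * O) := by
  rw [← mul_assoc]
  exact mul_le_mul_of_nonneg_right h.gamma_sq_le h.opt_pos.le

lemma rate_mul_delay_le : ρ * m ≤ γ := by
  rw [h.gamma_eq]
  exact mul_le_mul_of_nonneg_left (le_self_pow₀ h.one_le_delay two_ne_zero) h.rate_pos.le

lemma rate_le_one : ρ ≤ 1 := by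
  linarith [le_mul_of_one_le_right h.rate_pos.le h.one_le_delay, h.rate_mul_delay_le, h.gamma_le]

lemma rate_mul_le_half : ρ * (4 * m + 1) ≤ 1 / 2 := by
  linarith [le_mul_of_one_le_right h.rate_pos.le h.one_le_delay, h.rate_mul_delay_le, h.gamma_le]

lemma learningRate_pos : 0 < Real.log (1 / (1 - γ)) :=
  Real.log_pos ((one_lt_div (by linarith [h.gamma_le])).2 (by linarith [h.gamma_pos]))

lemma learningRate_le : Real.log (1 / (1 - γ)) ≤ γ * (1 + 2 * γ) :=
  log_inv_one_sub_le h.gamma_pos.le (by linarith [h.gamma_le])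

lemma one_sub_exp_neg_learningRate : 1 - Real.exp (-Real.log (1 / (1 - γ))) = γ := by
  rw [← Real.log_inv, one_div, inv_inv, Real.exp_log (by linarith [h.gamma_le]), sub_sub_cancel]

lemma one_le_gamma_mul_opt : 1 ≤ γ * O :=
  (one_le_mul_of_one_le_of_one_le h.one_le_diameter (one_le_pow₀ h.one_le_delay)).trans
    h.diameter_mul_le

lemma switches_mul_diameter_le : k * D ≤ γ * O := by
  have ⟨hD, hℓ, hm, hk, hO⟩ : 0 < D ∧ 1 ≤ ℓ ∧ 1 ≤ m ∧ 0 < k ∧ 0 < O :=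
    ⟨by linarith [h.one_le_diameter], h.one_le_card, h.one_le_delay,
      by linarith [h.one_le_switches], h.opt_pos⟩
  have := h.gamma_pos
  calc k * D ≤ k * D * (ℓ * m ^ 2) := le_mul_of_one_le_right (by positivity)
        (one_le_mul_of_one_le_of_one_le hℓ (one_le_pow₀ hm))
    _ = (D * ℓ * k) * m ^ 2 := by ring
    _ = γ ^ 2 * (γ * O) := by rw [← h.rate_pow, h.gamma_eq]; ring
    _ ≤ 1 * (γ * O) := by gcongr; linarith [h.gamma_sq_le, h.gamma_le]
    _ = γ * O := one_mul _

lemma regret_term_le {s : ℝ} (hs : s ≤ k) :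
    2 * D * ℓ * ((s + 2) * Real.log (2 * ℓ / γ ^ 2)) ≤ γ * ρ * (12 * (γ * Λ * O)) := by
  have ⟨hD, hℓ, hk, _⟩ : 0 < D ∧ 0 < ℓ ∧ 0 < k ∧ 0 < Λ :=
    ⟨by linarith [h.one_le_diameter], by linarith [h.one_le_card],
      by linarith [h.one_le_switches], by linarith [h.one_le_logFactor]⟩
  have log_nonneg : 0 ≤ Real.log (2 * ℓ / γ ^ 2) := by
    have := h.gamma_pos
    refine Real.log_nonneg ((one_le_div (by positivity)).2 ?_)
    linarith [h.gamma_sq_le, h.gamma_le, h.one_le_card]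
  calc 2 * D * ℓ * ((s + 2) * Real.log (2 * ℓ / γ ^ 2))
      ≤ 2 * D * ℓ * (3 * k * (2 * Λ)) := by
        gcongr
        · linarith [h.one_le_switches]
        · exact h.log_le
    _ = 12 * (D * ℓ * k) * Λ := by ring
    _ = γ * ρ * (12 * (γ * Λ * O)) := by rw [← h.rate_pow, h.gamma_eq]; ring

lemma benchmark_term_le {F : ℝ} (hF : F ≤ O + 1 + k * D) :
    Real.log (1 / (1 - γ)) * ρ * F ≤ γ * ρ * ((1 + 2 * γ) ^ 2 * O) := by
  have hO := h.opt_pos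
  have hρ := h.rate_pos
  have hη := h.learningRate_pos
  have hγ := h.gamma_pos
  calc Real.log (1 / (1 - γ)) * ρ * F ≤ Real.log (1 / (1 - γ)) * ρ * ((1 + 2 * γ) * O) := by
        gcongr
        linarith [h.one_le_gamma_mul_opt, h.switches_mul_diameter_le]
    _ ≤ γ * (1 + 2 * γ) * ρ * ((1 + 2 * γ) * O) := by gcongr; exact h.learningRate_le
    _ = γ * ρ * ((1 + 2 * γ) ^ 2 * O) := by ring

lemma explored_le {s F A : ℝ} (hs : s ≤ k) (hF : F ≤ O + 1 + k * D) (hA0 : 0 ≤ A)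
    (hA : (1 - γ ^ 2) * γ * A ≤ Real.log (1 / (1 - γ)) * ρ * F
      + 2 * D * ℓ * ((s + 2) * Real.log (2 * ℓ / γ ^ 2))) :
    A ≤ ρ * ((1 + 20 * (γ * Λ)) * O) := by
  have hO := h.opt_pos
  have hρ := h.rate_pos
  have hγ := h.gamma_pos
  have hγg := h.gamma_le_mul_logFactor
  have hg := h.gamma_mul_logFactor_le
  have hγ2 := h.gamma_sq_le
  set g := γ * Λ
  have : 0 < g := hγ.trans_le hγg
  have factor_le : (1 + 2 * γ) ^ 2 + 12 * g ≤ 1 + 17 * g := by linarith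
  have damped : (1 - g) * A ≤ ρ * ((1 + 17 * g) * O) := by
    refine le_of_mul_le_mul_left ?_ hγ
    calc γ * ((1 - g) * A) ≤ γ * ((1 - γ ^ 2) * A) := by gcongr; linarith
      _ ≤ γ * ρ * ((1 + 2 * γ) ^ 2 * O) + γ * ρ * (12 * (g * O)) := by
        linarith [h.regret_term_le hs, h.benchmark_term_le hF]
      _ = γ * (ρ * (((1 + 2 * γ) ^ 2 + 12 * g) * O)) := by ring
      _ ≤ γ * (ρ * ((1 + 17 * g) * O)) := by gcongr
  refine le_of_mul_le_mul_left (damped.trans ?_) (show 0 < 1 - g by linarith)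
  calc ρ * ((1 + 17 * g) * O) ≤ ρ * ((1 - g) * (1 + 20 * g) * O) := by
        gcongr
        nlinarith
    _ = (1 - g) * (ρ * ((1 + 20 * g) * O)) := by ring

lemma movement_le {A N : ℝ} (hN0 : 0 ≤ N) (hA : A ≤ ρ * ((1 + 20 * (γ * Λ)) * O))
    (hN : 2 * D * ℓ * N ≤ Real.log (1 / (1 - γ)) * A) : D * m ^ 2 * N ≤ 2 * (γ ^ 2 * O) := by
  have hO := h.opt_pos
  have hρ := h.rate_pos
  have hη := h.learningRate_pos
  have hγ := h.gamma_pos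
  have hD := h.one_le_diameter
  have hη2 : Real.log (1 / (1 - γ)) ≤ 2 * γ := by nlinarith [h.learningRate_le, h.gamma_le]
  have moved : 2 * (D * N) ≤ 2 * (2 * γ * (ρ * O)) :=
    calc 2 * (D * N) ≤ 2 * (D * N) * ℓ := le_mul_of_one_le_right (by positivity) h.one_le_card
      _ = 2 * D * ℓ * N := by ring
      _ ≤ Real.log (1 / (1 - γ)) * A := hN
      _ ≤ Real.log (1 / (1 - γ)) * (ρ * (2 * O)) := by
        gcongr
        refine hA.trans ?_
        gcongr
        linarith [h.gamma_mul_logFactor_le]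
      _ ≤ 2 * γ * (ρ * (2 * O)) := by gcongr
      _ = 2 * (2 * γ * (ρ * O)) := by ring
  calc D * m ^ 2 * N = m ^ 2 * (D * N) := by ring
    _ ≤ m ^ 2 * (2 * γ * (ρ * O)) := mul_le_mul_of_nonneg_left (by linarith) (sq_nonneg m)
    _ = 2 * (γ * (ρ * m ^ 2) * O) := by ring
    _ = 2 * (γ ^ 2 * O) := by rw [← h.gamma_eq, sq]

lemma fractional_le {A N C : ℝ} (hC0 : 0 ≤ C) (hN0 : 0 ≤ N)
    (hA : A ≤ ρ * ((1 + 20 * (γ * Λ)) * O)) (hN : D * m ^ 2 * N ≤ 2 * (γ ^ 2 * O))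
    (hC : ρ * (1 - ρ * m) * C ≤ A + 8 * D * m * ρ * N + ρ * (2 * D * m)) :
    C ≤ (1 + 26 * (γ * Λ)) * O := by
  have hO := h.opt_pos
  have hρ := h.rate_pos
  have hγ := h.gamma_pos
  have hD := h.one_le_diameter
  have hm := h.one_le_delay
  have hγg := h.gamma_le_mul_logFactor
  have hg := h.gamma_mul_logFactor_le
  have hρm := h.rate_mul_delay_le
  set g := γ * Λ
  have hγO0 : 0 < γ * O := by positivity
  have hγO : γ * O ≤ g * O := by gcongr
  have hDm : D * m ≤ D * m ^ 2 := by gcongr; exact le_self_pow₀ hm two_ne_zero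
  have hDmN : D * m * N ≤ 2 * (γ ^ 2 * O) := le_trans (by gcongr) hN
  have damped : (1 - g) * C ≤ (1 + 23 * g) * O := by
    refine le_of_mul_le_mul_left ?_ hρ
    calc ρ * ((1 - g) * C) ≤ ρ * ((1 - ρ * m) * C) := by gcongr; linarith
      _ ≤ ρ * ((1 + 20 * g) * O + 8 * (D * m * N) + 2 * (D * m)) := by linarith
      _ ≤ ρ * ((1 + 23 * g) * O) := by gcongr; linarith [h.diameter_mul_le, h.gamma_sq_mul_opt_le]
  refine le_of_mul_le_mul_left (damped.trans ?_) (show 0 < 1 - g by linarith)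
  calc (1 + 23 * g) * O ≤ (1 - g) * (1 + 26 * g) * O := by gcongr; nlinarith
    _ = (1 - g) * ((1 + 26 * g) * O) := mul_assoc _ _ _

lemma total_le {N C P : ℝ} (hC0 : 0 ≤ C) (hN0 : 0 ≤ N) (hC : C ≤ (1 + 26 * (γ * Λ)) * O)
    (hN : D * m ^ 2 * N ≤ 2 * (γ ^ 2 * O))
    (hP : P ≤ 10 * m * (2 * m * ρ * C + 7 * D * m * N + D * m)) :
    C + D * N + 5 * P ≤ (1 + 210 * (γ * Λ)) * O := by
  have hO := h.opt_pos
  have hγ := h.gamma_pos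
  have hD := h.one_le_diameter
  have hγg := h.gamma_le_mul_logFactor
  have hg := h.gamma_mul_logFactor_le
  set g := γ * Λ
  have hg0 : 0 < g := hγ.trans_le hγg
  have hγO0 : 0 < γ * O := by positivity
  have hγO : γ * O ≤ g * O := by gcongr
  have hgg : g * (g * O) ≤ 1 / 210 * (g * O) := by gcongr
  have hγC : γ * C ≤ g * ((1 + 26 * g) * O) := by gcongr
  have hDN : D * N ≤ D * m ^ 2 * N := by
    rw [mul_right_comm]
    exact le_mul_of_one_le_right (by positivity) (one_le_pow₀ h.one_le_delay)
  have overhead : P ≤ 20 * (γ * C) + 70 * (D * m ^ 2 * N) + 10 * (D * m ^ 2) :=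
    hP.trans_eq (by rw [h.gamma_eq]; ring)
  linarith [h.diameter_mul_le, h.gamma_sq_mul_opt_le]

end IsTuned

theorem Input.expectedCost_le_of_isTuned {M : Type*} [MetricSpace M] {ℓ : ℕ} [NeZero ℓ]
    (I : Input M ℓ) {m k : ℕ} {ρ γ Λ : ℝ} {greedy : ℕ → M → M}
    {τ : (Fin ℓ → ℝ) → (Fin ℓ → ℝ) → Fin ℓ → Fin ℓ → ℝ}
    (h : IsTuned (diameter M) ℓ m k (I.opt k) ρ γ Λ) (hg : I.IsGreedy greedy)
    (hτ : IsRounding τ) :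
    I.expectedCost m ρ (Real.log (1 / (1 - γ))) (γ ^ 2) τ greedy
      ≤ ENNReal.ofReal ((1 + 210 * (γ * Λ)) * I.opt k) := by
  have hD : 0 < diameter M := zero_lt_one.trans_le h.one_le_diameter
  have := boundedSpace_of_diameter_pos hD
  obtain ⟨a, ha, near_opt⟩ := I.exists_comparator h.opt_pos
  have hρ : ρ ∈ Set.Icc (0 : ℝ) 1 := ⟨h.rate_pos.le, h.rate_le_one⟩
  have hη := h.learningRate_pos.le
  have hα : 0 < γ ^ 2 := pow_pos h.gamma_pos 2
  have hα1 : γ ^ 2 ≤ 1 := by linarith [h.gamma_sq_le, h.gamma_le]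
  have hm : 1 ≤ m := by exact_mod_cast h.one_le_delay
  have hρm : ρ * m ≤ 1 := by linarith [h.rate_mul_delay_le, h.gamma_le]
  have regret := I.exploredTotal_le (m := m) hρ hη hD hα hα1 a
  rw [h.one_sub_exp_neg_learningRate] at regret
  have moved_nonneg := I.movementTotal_nonneg (m := m) (η := Real.log (1 / (1 - γ))) (α := γ ^ 2) hρ
  have followed_nonneg := I.fractionalTotal_nonneg (m := m) hρ hη hα.le
  have explored := h.explored_le (Nat.cast_le.2 ha) near_opt
    (I.exploredTotal_nonneg hρ hη hα.le) regret
  have moved := h.movement_le moved_nonneg explored (I.movementTotal_le hρ hη hα.le hD hα1)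
  have followed := h.fractional_le followed_nonneg moved_nonneg explored moved
    (I.mul_fractionalTotal_le hρ hη hα.le hρm hm)
  exact (I.expectedCost_le hη hα.le hτ hρ hg).trans (ENNReal.ofReal_le_ofReal
    (h.total_le followed_nonneg moved_nonneg followed moved
      (I.sum_coinExp_accumulated_meanOverhead_le hη hα.le hρ h.rate_mul_le_half hm)))

section Parameters

variable {D O : ℝ} {ℓ m k : ℕ}

lemma logArg_pow (hD : 0 ≤ D) (hO : 0 ≤ O) :
    logArg D ℓ m O ^ 3 = ℓ * O ^ 2 / (D ^ 2 * m ^ 4) := by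
  have rpow_two_thirds_pow {x : ℝ} (hx : 0 ≤ x) : (x ^ (2 / 3 : ℝ)) ^ 3 = x ^ 2 := by
    rw [← Real.rpow_natCast, ← Real.rpow_mul hx, ← Real.rpow_natCast]
    norm_num
  have rpow_four_thirds_pow : ((m : ℝ) ^ (4 / 3 : ℝ)) ^ 3 = (m : ℝ) ^ 4 := by
    rw [← Real.rpow_natCast, ← Real.rpow_mul (Nat.cast_nonneg m), ← Real.rpow_natCast]
    norm_num
  rw [logArg, div_pow, mul_pow, mul_pow, rpow_third_pow (Nat.cast_nonneg _),
    rpow_two_thirds_pow hO, rpow_two_thirds_pow hD, rpow_four_thirds_pow]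

lemma logArg_nonneg (hD : 0 ≤ D) (hO : 0 ≤ O) : 0 ≤ logArg D ℓ m O := by
  unfold logArg
  positivity

lemma opt_pos_of_regime (hD : 0 < D) (hℓ : 1 ≤ ℓ) (hm : 1 ≤ m) (hO : 0 ≤ O)
    (regime : D * ℓ * m ≤ 1 / 2 * O ^ (1 / 3 : ℝ)) : 0 < O := by
  refine hO.lt_of_ne fun hzero => ?_
  rw [← hzero, Real.zero_rpow (by norm_num), mul_zero] at regime
  exact regime.not_gt (by positivity)

lemma eight_mul_pow_le_of_le_rpow (hD : 0 ≤ D) (hO : 0 ≤ O)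
    (regime : D * ℓ * m ≤ 1 / 2 * O ^ (1 / 3 : ℝ)) : 8 * (D * ℓ * m) ^ 3 ≤ O := by
  have cubed := pow_le_pow_left₀ (by positivity) regime 3
  rw [mul_pow (1 / 2 : ℝ), rpow_third_pow hO] at cubed
  linarith

lemma four_le_logArg (hD : 1 ≤ D) (hℓ : 1 ≤ ℓ) (hm : 1 ≤ m)
    (hO : 8 * (D * ℓ * m) ^ 3 ≤ O) : 4 ≤ logArg D ℓ m O := by
  have hℓ1 : (1 : ℝ) ≤ ℓ := by exact_mod_cast hℓ
  have hm1 : (1 : ℝ) ≤ m := by exact_mod_cast hm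
  have hO0 : 0 ≤ O := le_trans (by positivity) hO
  refine le_of_pow_le_pow_left₀ three_ne_zero (logArg_nonneg (by linarith) hO0) ?_
  rw [logArg_pow (by linarith) hO0, le_div_iff₀ (by positivity)]
  have one_le : 1 ≤ D ^ 4 * (ℓ : ℝ) ^ 7 * (m : ℝ) ^ 2 :=
    one_le_mul_of_one_le_of_one_le
      (one_le_mul_of_one_le_of_one_le (one_le_pow₀ hD) (one_le_pow₀ hℓ1)) (one_le_pow₀ hm1)
  calc (4 : ℝ) ^ 3 * (D ^ 2 * m ^ 4)
      ≤ 4 ^ 3 * (D ^ 2 * m ^ 4) * (D ^ 4 * ℓ ^ 7 * m ^ 2) :=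
        le_mul_of_one_le_right (by positivity) one_le
    _ = ℓ * (8 * (D * ℓ * m) ^ 3) ^ 2 := by ring
    _ ≤ ℓ * O ^ 2 := by gcongr

lemma one_le_log_logArg (hD : 1 ≤ D) (hℓ : 1 ≤ ℓ) (hm : 1 ≤ m)
    (hO : 8 * (D * ℓ * m) ^ 3 ≤ O) : 1 ≤ Real.log (logArg D ℓ m O) := by
  have four_le := four_le_logArg hD hℓ hm hO
  rw [Real.le_log_iff_exp_le (by linarith)]
  linarith [Real.exp_one_lt_d9]

lemma shareParam_eq_gammaParam_sq (hD : 0 ≤ D) (hO : 0 ≤ O) :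
    shareParam D ℓ m k O = gammaParam D ℓ m k O ^ 2 := by
  rw [gammaParam, Real.sq_sqrt, shareParam]
  unfold exploreRate
  positivity

section Balance

variable (hD : 0 < D) (hO : 0 < O) (hm : 1 ≤ m)
include hD hO hm

lemma exploreRate_pow : exploreRate D ℓ m k O ^ 3 * m ^ 4 * O = D * ℓ * k := by
  have hm0 : (0 : ℝ) < m := by exact_mod_cast hm
  have opt_pow : (O ^ (-(1 / 3) : ℝ)) ^ 3 = O⁻¹ := by
    rw [← Real.rpow_natCast, ← Real.rpow_mul hO.le, ← Real.rpow_neg_one]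
    norm_num
  have delay_pow : ((m : ℝ) ^ (-(4 / 3) : ℝ)) ^ 3 = ((m : ℝ) ^ 4)⁻¹ := by
    rw [← Real.rpow_natCast, ← Real.rpow_mul hm0.le, ← Real.rpow_natCast, ← Real.rpow_neg hm0.le]
    norm_num
  rw [exploreRate, mul_pow, mul_pow, opt_pow, delay_pow, rpow_third_pow (by positivity)]
  field_simp

variable (hℓ : 1 ≤ ℓ) (hk : 1 ≤ k)
include hℓ hk

lemma exploreRate_pos : 0 < exploreRate D ℓ m k O := by
  unfold exploreRate
  positivity

lemma gammaParam_eq : gammaParam D ℓ m k O = exploreRate D ℓ m k O * m ^ 2 := by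
  have hρ := exploreRate_pos hD hO hm hℓ hk
  rw [gammaParam, ← exploreRate_pow hD hO hm, Real.sqrt_eq_iff_mul_self_eq (by positivity)
    (by positivity)]
  field_simp

lemma gammaParam_pow : gammaParam D ℓ m k O ^ 3 * O = D * ℓ * k * m ^ 2 := by
  rw [gammaParam_eq hD hO hm hℓ hk, ← exploreRate_pow hD hO hm]
  ring

lemma gammaParam_pos : 0 < gammaParam D ℓ m k O := by
  have hρ := exploreRate_pos hD hO hm hℓ hk
  rw [gammaParam_eq hD hO hm hℓ hk]
  positivity

lemma div_gammaParam_sq_le_logArg : ℓ / gammaParam D ℓ m k O ^ 2 ≤ logArg D ℓ m O := by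
  have hk1 : (1 : ℝ) ≤ k := by exact_mod_cast hk
  have hγ := gammaParam_pos hD hO hm hℓ hk
  refine le_of_pow_le_pow_left₀ three_ne_zero (logArg_nonneg hD.le hO.le) ?_
  rw [logArg_pow hD.le hO.le, div_pow, div_le_div_iff₀ (by positivity) (by positivity)]
  calc (ℓ : ℝ) ^ 3 * (D ^ 2 * m ^ 4) ≤ ℓ ^ 3 * (D ^ 2 * m ^ 4) * k ^ 2 :=
        le_mul_of_one_le_right (by positivity) (one_le_pow₀ hk1)
    _ = ℓ * (D * ℓ * k * m ^ 2) ^ 2 := by ring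
    _ = ℓ * O ^ 2 * (gammaParam D ℓ m k O ^ 2) ^ 3 := by
        rw [← gammaParam_pow hD hO hm hℓ hk]
        ring

lemma log_two_mul_div_le (hZ : 2 ≤ logArg D ℓ m O) :
    Real.log (2 * ℓ / gammaParam D ℓ m k O ^ 2) ≤ 2 * Real.log (logArg D ℓ m O) := by
  have hγ := gammaParam_pos hD hO hm hℓ hk
  calc Real.log (2 * ℓ / gammaParam D ℓ m k O ^ 2) ≤ Real.log (logArg D ℓ m O ^ 2) := by
        refine Real.log_le_log (by positivity) ?_
        rw [mul_div_assoc, sq (logArg D ℓ m O)]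
        gcongr
        exact div_gammaParam_sq_le_logArg hD hO hm hℓ hk
    _ = 2 * Real.log (logArg D ℓ m O) := by rw [Real.log_pow, Nat.cast_ofNat]

lemma gammaParam_mul_le {c ε Λ : ℝ} (hc : 0 ≤ c) (hε : 0 ≤ ε) (hΛ : 0 < Λ)
    (hkc : k ≤ c ^ 3 * (ε ^ 3 * O / (D * ℓ * m ^ 2 * Λ ^ 3))) :
    gammaParam D ℓ m k O * Λ ≤ c * ε := by
  refine le_of_pow_le_pow_left₀ three_ne_zero (by positivity) (le_of_mul_le_mul_right ?_ hO)
  rw [← mul_div_assoc, le_div_iff₀ (by positivity)] at hkc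
  calc (gammaParam D ℓ m k O * Λ) ^ 3 * O = gammaParam D ℓ m k O ^ 3 * O * Λ ^ 3 := by ring
    _ = k * (D * ℓ * m ^ 2 * Λ ^ 3) := by rw [gammaParam_pow hD hO hm hℓ hk]; ring
    _ ≤ c ^ 3 * (ε ^ 3 * O) := hkc
    _ = (c * ε) ^ 3 * O := by ring

end Balance

lemma diameter_mul_le_gammaParam_mul (hD : 1 ≤ D) (hO : 0 < O) (hm : 1 ≤ m) (hℓ : 1 ≤ ℓ)
    (hk : 1 ≤ k) (hO8 : 8 * (D * ℓ * m) ^ 3 ≤ O) :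
    D * m ^ 2 ≤ gammaParam D ℓ m k O * O := by
  have hℓ1 : (1 : ℝ) ≤ ℓ := by exact_mod_cast hℓ
  have hm1 : (1 : ℝ) ≤ m := by exact_mod_cast hm
  have hk1 : (1 : ℝ) ≤ k := by exact_mod_cast hk
  have hD0 : 0 < D := zero_lt_one.trans_le hD
  have hγ := gammaParam_pos hD0 hO hm hℓ hk
  have one_le : 1 ≤ D ^ 4 * (ℓ : ℝ) ^ 7 * k * (m : ℝ) ^ 2 :=
    one_le_mul_of_one_le_of_one_le (one_le_mul_of_one_le_of_one_le
      (one_le_mul_of_one_le_of_one_le (one_le_pow₀ hD) (one_le_pow₀ hℓ1)) hk1) (one_le_pow₀ hm1)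
  have cube_le : (D * ℓ * m) ^ 3 ≤ O := by linarith [show 0 ≤ (D * ℓ * m) ^ 3 by positivity]
  refine le_of_pow_le_pow_left₀ three_ne_zero (by positivity) ?_
  calc (D * m ^ 2) ^ 3 ≤ (D * m ^ 2) ^ 3 * (D ^ 4 * ℓ ^ 7 * k * m ^ 2) :=
        le_mul_of_one_le_right (by positivity) one_le
    _ = D * ℓ * k * m ^ 2 * ((D * ℓ * m) ^ 3) ^ 2 := by ring
    _ ≤ D * ℓ * k * m ^ 2 * O ^ 2 := by gcongr
    _ = (gammaParam D ℓ m k O * O) ^ 3 := by rw [← gammaParam_pow hD0 hO hm hℓ hk]; ring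

lemma isTuned_params (hD : 1 ≤ D) (hO : 0 < O) (hm : 1 ≤ m) (hℓ : 1 ≤ ℓ) (hk : 1 ≤ k)
    (hO8 : 8 * (D * ℓ * m) ^ 3 ≤ O)
    (hγΛ : gammaParam D ℓ m k O * Real.log (logArg D ℓ m O) ≤ 1 / 210) :
    IsTuned D ℓ m k O (exploreRate D ℓ m k O) (gammaParam D ℓ m k O)
      (Real.log (logArg D ℓ m O)) where
  one_le_diameter := hD
  one_le_card := by exact_mod_cast hℓ
  one_le_delay := by exact_mod_cast hm
  one_le_switches := by exact_mod_cast hk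
  opt_pos := hO
  rate_pos := exploreRate_pos (zero_lt_one.trans_le hD) hO hm hℓ hk
  gamma_eq := gammaParam_eq (zero_lt_one.trans_le hD) hO hm hℓ hk
  rate_pow := exploreRate_pow (zero_lt_one.trans_le hD) hO hm
  diameter_mul_le := diameter_mul_le_gammaParam_mul hD hO hm hℓ hk hO8
  one_le_logFactor := one_le_log_logArg hD hℓ hm hO8
  gamma_mul_logFactor_le := hγΛ
  log_le := log_two_mul_div_le (zero_lt_one.trans_le hD) hO hm hℓ hk
    (by linarith [four_le_logArg hD hℓ hm hO8])

end Parameters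

end MTS

end

theorem mainTheorem6 :
    ∃ c₀ : ℝ, 0 < c₀ ∧ ∃ c : ℝ, 0 < c ∧
      ∀ (M : Type*) [MetricSpace M] (ℓ : ℕ) [NeZero ℓ] (m k : ℕ) (I : MTS.Input M ℓ)
        (greedy : ℕ → M → M) (τ : (Fin ℓ → ℝ) → (Fin ℓ → ℝ) → Fin ℓ → Fin ℓ → ℝ) (ε : ℝ),
        2 ≤ m → 1 ≤ k → 0 < ε → ε ≤ 1 →
        I.IsGreedy greedy → MTS.IsRounding τ →
        1 ≤ MTS.diameter M →
        MTS.diameter M * ℓ * m ≤ c₀ * I.opt k ^ (1 / 3 : ℝ) →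
        (k : ℝ) ≤ c * (ε ^ 3 * I.opt k /
          (MTS.diameter M * ℓ * m ^ 2 *
            Real.log (MTS.logArg (MTS.diameter M) ℓ m (I.opt k)) ^ 3)) →
        (MTS.exploreRate (MTS.diameter M) ℓ m k (I.opt k) ∈ Set.Ioc (0 : ℝ) 1 ∧
          MTS.shareParam (MTS.diameter M) ℓ m k (I.opt k) ∈ Set.Ioc (0 : ℝ) (1 / 2) ∧
          0 < MTS.learningRate (MTS.diameter M) ℓ m k (I.opt k)) ∧
        I.expectedCost m
            (MTS.exploreRate (MTS.diameter M) ℓ m k (I.opt k))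
            (MTS.learningRate (MTS.diameter M) ℓ m k (I.opt k))
            (MTS.shareParam (MTS.diameter M) ℓ m k (I.opt k)) τ greedy
          ≤ ENNReal.ofReal ((1 + ε) * I.opt k) := by
  refine ⟨1 / 2, by norm_num, (1 / 210) ^ 3, by norm_num, ?_⟩
  intro M _ ℓ _ m k I greedy τ ε hm2 hk hε hε1 hg hτ hD regime hkc
  have hm : 1 ≤ m := by omega
  have hℓ : 1 ≤ ℓ := NeZero.one_le
  have hD0 : 0 < MTS.diameter M := zero_lt_one.trans_le hD
  have hO : 0 < I.opt k :=
    MTS.opt_pos_of_regime hD0 hℓ hm ENNReal.toReal_nonneg regime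
  have hO8 := MTS.eight_mul_pow_le_of_le_rpow hD0.le hO.le regime
  have hΛ := MTS.one_le_log_logArg hD hℓ hm hO8
  have hγΛ := MTS.gammaParam_mul_le hD0 hO hm hℓ hk (by norm_num) hε.le (by linarith) hkc
  have tuned := MTS.isTuned_params hD hO hm hℓ hk hO8 (by linarith)
  rw [MTS.shareParam_eq_gammaParam_sq hD0.le hO.le]
  refine ⟨⟨⟨tuned.rate_pos, tuned.rate_le_one⟩, ⟨pow_pos tuned.gamma_pos 2, ?_⟩,
    tuned.learningRate_pos⟩, ?_⟩
  · linarith [tuned.gamma_sq_le, tuned.gamma_le]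
  · refine (I.expectedCost_le_of_isTuned tuned hg hτ).trans (ENNReal.ofReal_le_ofReal ?_)
    exact mul_le_mul_of_nonneg_right (by linarith) hO.le
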